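/- **Setting.** Everything is over a field $\Bbbk$. Let $A$, $B$ be (associative unital) algebras that are also (coassociative counital) coalgebras, such that $\epsilon_A,\epsilon_B$ are algebra maps and the units $\eta_A,\eta_B$ are coalgebra maps (neither $A$ nor $B$ need be a bialgebra). Let $\sigma:B\otimes A\to A\otimes B$, $b\otimes a\mapsto\sum a_\sigma\otimes b_\sigma$, and $\tau:A\otimes B\to B\otimes A$, $a\otimes b\mapsto\sum b_\tau\otimes a_\tau$, be linear maps. Indexed copies $\sigma_1,\sigma_2,\dots$ and $\tau_1,\tau_2,\dots$ denote further applications of $\sigma$, $\tau$; with several subscripts on one element, they are applied from left to right. Suppose that $A{_\tau\times_\sigma}B$ is a *smash biproduct bialgebra*: the space $A\otimes B$ with multiplication $(a\otimes b)(a'\otimes b')=\sum aa'_\sigma\otimes b_\sigma b'$, unit $1_A\otimes 1_B$, comultiplication $a\otimes b\mapsto\sum (a_{(1)}\otimes b_{(1)\tau})\otimes (a_{(2)\tau}\otimes b_{(2)})$ and counit $\epsilon_A\otimes\epsilon_B$ is a bialgebra. Suppose that $\sigma$ is *right conormal*: $\sum\epsilon_A(a_\sigma)b_\sigma=\epsilon_A(a)b$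 for all $a\in A$, $b\in B$. For $U,V\in\{A,B\}$, an element $P=\sum P^1\otimes P^2\in U\otimes V$ is *normalized* if $\sum\epsilon_U(P^1)P^2=1_V$ and $\sum P^1\epsilon_V(P^2)=1_U$. A *quasitriangular structure* of a bialgebra $H$ is an element $\mathcal R\in H\otimes H$ (not required to be invertible) with - (QT1) $(\epsilon_H\otimes id)(\mathcal R)=1_H=(id\otimes\epsilon_H)(\mathcal R)$; - (QT2) $(\Delta_H\otimes id)(\mathcal R)=\mathcal R_{13}\mathcal R_{23}$; - (QT3) $(id\otimes\Delta_H)(\mathcal R)=\mathcal R_{13}\mathcal R_{12}$; - (QT4) $\mathcal R\,\Delta_H(h)=\Delta_H^{cop}(h)\,\mathcal R$ for all $h\in H$. **Theorem 3.6.** Let $W=\sum W^1\otimes W^2\in B\otimes B$, $X=\sum X^1\otimes X^2\in A\otimes B$, $Y=\sum Y^1\otimes Y^2\in B\otimes A$ and $Z=\sum Z^1\otimes Z^2\in A\otimes A$ be normalized elements satisfying, for all $a\in A$ and $b\in B$ (bars denote further copies of the same element, and $1=1_B$ wherever it carries a subscript $\tau_i$ without the letter $A$), - C1) $\sum Z^1_{\tau_1\tau_2}\bar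 X^1_{\tau_3}X^1a_{(1)\sigma_3}\epsilon_B((W^1Y^1)_{\sigma_3})\otimes Z^2Y^2_{\sigma_1\sigma_2}a_{(2)\sigma_4}\,\epsilon_B(1_{\tau_1\sigma_2}\bar X^2_{\sigma_1})\,\epsilon_B((1_{\tau_2}1_{\tau_3}X^2W^2)_{\sigma_4})=\sum a_{(2)\tau}Z^1\otimes a_{(1)}Z^2_\sigma\,\epsilon_B(1_{\tau\sigma})$; - C2) $\sum X^1a_\sigma\epsilon_B(W^1_\sigma)\otimes X^2W^2=\sum a_\tau X^1\otimes 1_\tau X^2$; - C3) $\sum W^1Y^1 1_\tau\otimes Y^2a_{\tau\sigma}\epsilon_B(W^2_\sigma)=\sum Y^1\otimes aY^2$; - C4) $\sum Z^1\otimes Z^2\epsilon_B(b)=\sum 1_{A\tau}Z^1_{\sigma_1}\otimes Z^2_{\sigma_2}\,\epsilon_B(b_{(1)\tau\sigma_2})\,\epsilon_B(b_{(2)\sigma_1})$; - C5) $\sum X^1\otimes X^2b=\sum 1_{A\tau}X^1_\sigma\epsilon_B(b_{(2)\sigma})\otimes b_{(1)\tau}X^2$; - C6) $\sum W^1Y^1b_\tau\otimes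 Y^21_{A\tau\sigma}\epsilon_B(W^2_\sigma)=\sum b_\sigma Y^1\otimes Y^2_\sigma$; - C7) $\sum W^1b_{(1)}\otimes W^2b_{(2)}=\sum b_{(2)}W^1\otimes b_{(1)}W^2$; - C8) $\sum Z^1_{(1)}\otimes Z^1_{(2)}\otimes Z^2=\sum Z^1_\tau X^1\otimes\bar Z^1\otimes Z^2\bar Z^2_\sigma\,\epsilon_B((1_\tau X^2)_\sigma)$; - C9) $\sum X^1_{(1)}\otimes X^1_{(2)}\otimes X^2=\sum X^1\otimes\bar X^1\otimes X^2\bar X^2$; - C10) $\sum Y^1_{\tau_1}\otimes(Z^1_{\tau_2}X^1)_{\tau_1}\otimes Z^2Y^2_\sigma\,\epsilon_B((1_{\tau_2}X^2)_\sigma)=\sum W^1Y^1\otimes Z^1\otimes Y^2Z^2_\sigma\,\epsilon_B(W^2_\sigma)$; - C11) $\sum W^1_\tau\otimes X^1_\tau\otimes X^2W^2=\sum W^1\otimes X^1\otimes W^2X^2$; - C12) $\sum Y^1_{(1)}\otimes Y^1_{(2)}\otimes Y^2=\sum W^1Y^1\otimes\bar Y^1\otimes Y^2\bar Y^2_\sigma\,\epsilon_B(W^2_\sigma)$;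 - C13) $\sum W^1_{(1)}\otimes W^1_{(2)}\otimes W^2=\sum W^1\otimes\bar W^1\otimes W^2\bar W^2$; - C14) $\sum Z^1\otimes Z^2_{(1)}\otimes Z^2_{(2)}=\sum Z^1_\tau X^1\bar Z^1_{\sigma_1}\epsilon_B(Y^1_{\sigma_1})\otimes\bar Z^2\otimes Z^2Y^2_{\sigma_2}\,\epsilon_B((1_\tau X^2)_{\sigma_2})$; - C15) $\sum Z^1_{\tau_1}X^1\otimes(1_{\tau_1}X^2)_{\tau_2}\otimes Z^2_{\tau_2}=\sum Z^1_\tau X^1\bar X^1_{\sigma_1}\epsilon_B(Y^1_{\sigma_1})\otimes\bar X^2\otimes Z^2Y^2_{\sigma_2}\,\epsilon_B((1_\tau X^2)_{\sigma_2})$; - C16) $\sum X^1\otimes X^2_{(1)}\otimes X^2_{(2)}=\sum X^1\bar X^1_\sigma\epsilon_B(W^1_\sigma)\otimes\bar X^2\otimes X^2W^2$; - C17) $\sum Y^1\otimes Y^2_{(1)}\otimes Y^2_{(2)}=\sum Y^1\bar Y^1\otimes\bar Y^2\otimes Y^2$; - C18) $\sum W^1Y^1\otimes W^2_\tau\otimes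 Y^2_\tau=\sum Y^1W^1\otimes W^2\otimes Y^2$; - C19) $\sum W^1\otimes W^2_{(1)}\otimes W^2_{(2)}=\sum W^1\bar W^1\otimes\bar W^2\otimes W^2$. Then $$\alpha=\sum \big(Z^1_{\tau_1\tau_2}\bar X^1_{\tau_3}X^1\otimes W^1Y^1\big)\otimes \big(Z^2Y^2_{\sigma_1\sigma_2}\,\epsilon_B(1_{\tau_1\sigma_2}\bar X^2_{\sigma_1})\otimes 1_{\tau_2}1_{\tau_3}X^2W^2\big)$$ is a quasitriangular structure of the bialgebra $A{_\tau\times_\sigma}B$. -/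

import Mathlib

open scoped TensorProduct
open TensorProduct

section Sweedler

variable {k M N P : Type*} [CommSemiring k] [AddCommMonoid M] [AddCommMonoid N] [AddCommMonoid P]
  [Module k M] [Module k N] [Module k P]

/-- Sweedler summation. For `t = ∑ i, m i ⊗ n i`, the element `sw t f` is `∑ i, f (m i) (n i)`.
It is only used for expressions `f` that are bilinear over `k`, and then (see `sw_eq_sum`) the value
does not depend on how `t` is written as a sum of pure tensors. -/
noncomputable def sw (t : M ⊗[k] N) (f : M → N → P) : P :=
  ∑ p ∈ (TensorProduct.exists_finset t).choose, f p.1 p.2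

theorem sw_eq_lift (t : M ⊗[k] N) (f : M →ₗ[k] N →ₗ[k] P) :
    sw t (fun m n => f m n) = TensorProduct.lift f t := by
  conv_rhs => rw [(TensorProduct.exists_finset t).choose_spec]
  simp [sw, map_sum]

theorem sw_eq_sum {ι : Type*} (s : Finset ι) (m : ι → M) (n : ι → N) (f : M →ₗ[k] N →ₗ[k] P) :
    sw (∑ i ∈ s, m i ⊗ₜ[k] n i) (fun x y => f x y) = ∑ i ∈ s, f (m i) (n i) := by
  rw [sw_eq_lift]
  simp [map_sum]

end Sweedler

section Quasitriangular

variable (k : Type*) [Field k] (H : Type*) [Ring H] [Bialgebra k H]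

/-- `R ↦ R₁₂ = ∑ R¹ ⊗ R² ⊗ 1`. -/
noncomputable def leg12 : H ⊗[k] H →ₐ[k] (H ⊗[k] H) ⊗[k] H :=
  Algebra.TensorProduct.includeLeft

/-- `R ↦ R₁₃ = ∑ R¹ ⊗ 1 ⊗ R²`. -/
noncomputable def leg13 : H ⊗[k] H →ₐ[k] (H ⊗[k] H) ⊗[k] H :=
  Algebra.TensorProduct.map Algebra.TensorProduct.includeLeft (AlgHom.id k H)

/-- `R ↦ R₂₃ = ∑ 1 ⊗ R¹ ⊗ R²`. -/
noncomputable def leg23 : H ⊗[k] H →ₐ[k] (H ⊗[k] H) ⊗[k] H :=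
  Algebra.TensorProduct.map Algebra.TensorProduct.includeRight (AlgHom.id k H)

variable {H}

/-- `R` is a quasitriangular structure of the bialgebra `H`
(invertibility of `R` is not part of the definition for bialgebras). -/
structure IsQuasitriangularStructure (R : H ⊗[k] H) : Prop where
  counit_left : TensorProduct.lid k H
    (TensorProduct.map (Coalgebra.counit (R := k)) LinearMap.id R) = 1
  counit_right : TensorProduct.rid k H
    (TensorProduct.map LinearMap.id (Coalgebra.counit (R := k)) R) = 1
  comul_left : TensorProduct.map (Coalgebra.comul (R := k)) LinearMap.id R
    = leg13 k H R * leg23 k H R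
  comul_right : (TensorProduct.assoc k H H H).symm
    (TensorProduct.map LinearMap.id (Coalgebra.comul (R := k)) R) = leg13 k H R * leg12 k H R
  mul_comul : ∀ h : H, R * Coalgebra.comul (R := k) h
    = TensorProduct.comm k H H (Coalgebra.comul (R := k) h) * R

end Quasitriangular

section Conormal

variable {k C D : Type*} [Field k] [AddCommGroup C] [Module k C] [Coalgebra k C]
  [AddCommGroup D] [Module k D] [Coalgebra k D]

/-- A linear map `φ : C ⊗ D → D ⊗ C` is right conormal if `(ε ⊗ id) ∘ φ = id ⊗ ε`. -/
def IsRightConormal (φ : C ⊗[k] D →ₗ[k] D ⊗[k] C) : Prop :=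
  (TensorProduct.lid k C).toLinearMap ∘ₗ
      TensorProduct.map (Coalgebra.counit (R := k) (A := D)) (LinearMap.id (R := k) (M := C)) ∘ₗ φ
    = (TensorProduct.rid k C).toLinearMap ∘ₗ
      TensorProduct.map (LinearMap.id (R := k) (M := C)) (Coalgebra.counit (R := k) (A := D))

end Conormal

section Smash

variable (k A B : Type*) [Field k] [Ring A] [Algebra k A] [Coalgebra k A]
  [Ring B] [Algebra k B] [Coalgebra k B]

/-- The counit is an algebra map. -/
structure IsCounitalAlgebra : Prop where
  counit_one : Coalgebra.counit (R := k) (1 : A) = 1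
  counit_mul : ∀ a b : A, Coalgebra.counit (R := k) (a * b)
    = Coalgebra.counit (R := k) a * Coalgebra.counit (R := k) b

/-- The unit is a coalgebra map. -/
structure IsUnitalCoalgebra : Prop where
  counit_one : Coalgebra.counit (R := k) (1 : A) = 1
  comul_one : Coalgebra.comul (R := k) (1 : A) = 1 ⊗ₜ[k] 1

variable {k A B}

/-- `(a ⊗ b) ⊗ (a' ⊗ b') ↦ ∑ a a'_σ ⊗ b_σ b'`. -/
noncomputable def smashMul (σ : B ⊗[k] A →ₗ[k] A ⊗[k] B) :
    (A ⊗[k] B) ⊗[k] (A ⊗[k] B) →ₗ[k] A ⊗[k] B :=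
  TensorProduct.map (LinearMap.mul' k A) (LinearMap.mul' k B) ∘ₗ
    (TensorProduct.tensorTensorTensorAssoc k A A B B).symm.toLinearMap ∘ₗ
    TensorProduct.map (TensorProduct.map LinearMap.id σ) LinearMap.id ∘ₗ
    (TensorProduct.tensorTensorTensorAssoc k A B A B).toLinearMap

/-- `a ⊗ b ↦ ∑ (a₍₁₎ ⊗ b₍₁₎_τ) ⊗ (a₍₂₎_τ ⊗ b₍₂₎)`. -/
noncomputable def smashComul (τ : A ⊗[k] B →ₗ[k] B ⊗[k] A) :
    A ⊗[k] B →ₗ[k] (A ⊗[k] B) ⊗[k] (A ⊗[k] B) :=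
  (TensorProduct.tensorTensorTensorAssoc k A B A B).symm.toLinearMap ∘ₗ
    TensorProduct.map (TensorProduct.map LinearMap.id τ) LinearMap.id ∘ₗ
    (TensorProduct.tensorTensorTensorAssoc k A A B B).toLinearMap ∘ₗ
    TensorProduct.map (Coalgebra.comul (R := k)) (Coalgebra.comul (R := k))

variable (k A B) in
/-- `a ⊗ b ↦ ε(a) ε(b)`. -/
noncomputable def smashCounit : A ⊗[k] B →ₗ[k] k :=
  LinearMap.mul' k k ∘ₗ
    TensorProduct.map (Coalgebra.counit (R := k)) (Coalgebra.counit (R := k))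

/-- `A ⊗ B` with the multiplication `smashMul σ` is an algebra with unit `1 ⊗ 1`. -/
structure IsSmashProduct (σ : B ⊗[k] A →ₗ[k] A ⊗[k] B) : Prop where
  mul_assoc : ∀ x y z : A ⊗[k] B,
    smashMul σ (smashMul σ (x ⊗ₜ y) ⊗ₜ z) = smashMul σ (x ⊗ₜ smashMul σ (y ⊗ₜ z))
  one_mul : ∀ x : A ⊗[k] B, smashMul σ ((1 ⊗ₜ 1) ⊗ₜ x) = x
  mul_one : ∀ x : A ⊗[k] B, smashMul σ (x ⊗ₜ (1 ⊗ₜ 1)) = x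

/-- `A ⊗ B` with the comultiplication `smashComul τ` is a coalgebra with counit `ε ⊗ ε`. -/
structure IsSmashCoproduct (τ : A ⊗[k] B →ₗ[k] B ⊗[k] A) : Prop where
  coassoc : (TensorProduct.assoc k (A ⊗[k] B) (A ⊗[k] B) (A ⊗[k] B)).toLinearMap ∘ₗ
      (smashComul τ).rTensor (A ⊗[k] B) ∘ₗ smashComul τ
    = (smashComul τ).lTensor (A ⊗[k] B) ∘ₗ smashComul τ
  counit_comul : (smashCounit k A B).rTensor (A ⊗[k] B) ∘ₗ smashComul τ
    = TensorProduct.mk k k (A ⊗[k] B) 1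
  comul_counit : (smashCounit k A B).lTensor (A ⊗[k] B) ∘ₗ smashComul τ
    = (TensorProduct.mk k (A ⊗[k] B) k).flip 1

variable (k A B) in
/-- A smash biproduct bialgebra of `A` and `B`: maps `σ`, `τ` for which the smash product
and the smash coproduct on `A ⊗ B` together form a bialgebra. As a standing convention, `A` and `B`
are algebras and coalgebras whose counits are algebra maps and whose units are coalgebra maps
(neither `A` nor `B` has to be a bialgebra). -/
structure SmashBiproduct where
  σ : B ⊗[k] A →ₗ[k] A ⊗[k] B
  τ : A ⊗[k] B →ₗ[k] B ⊗[k] A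
  counital_left : IsCounitalAlgebra k A
  counital_right : IsCounitalAlgebra k B
  unital_left : IsUnitalCoalgebra k A
  unital_right : IsUnitalCoalgebra k B
  isSmashProduct : IsSmashProduct σ
  isSmashCoproduct : IsSmashCoproduct τ
  counit_one : smashCounit k A B (1 ⊗ₜ 1) = 1
  counit_mul : ∀ x y : A ⊗[k] B,
    smashCounit k A B (smashMul σ (x ⊗ₜ y)) = smashCounit k A B x * smashCounit k A B y
  comul_one : smashComul τ (1 ⊗ₜ 1) = (1 ⊗ₜ 1) ⊗ₜ (1 ⊗ₜ 1)
  comul_mul : ∀ x y : A ⊗[k] B,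
    smashComul τ (smashMul σ (x ⊗ₜ y))
      = TensorProduct.map (smashMul σ) (smashMul σ)
          (TensorProduct.tensorTensorTensorComm k (A ⊗[k] B) (A ⊗[k] B) (A ⊗[k] B) (A ⊗[k] B)
            (smashComul τ x ⊗ₜ smashComul τ y))

namespace SmashBiproduct

/-- The underlying space `A ⊗ B` of the smash biproduct. -/
def Carrier (_S : SmashBiproduct k A B) : Type _ := A ⊗[k] B

variable (S : SmashBiproduct k A B)

noncomputable instance instAddCommGroup : AddCommGroup S.Carrier :=
  inferInstanceAs (AddCommGroup (A ⊗[k] B))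

noncomputable instance instModule : Module k S.Carrier :=
  inferInstanceAs (Module k (A ⊗[k] B))

/-- The identification of `A ⊗ B` with the underlying space of the smash biproduct. -/
noncomputable def ofTensor : A ⊗[k] B ≃ₗ[k] S.Carrier := LinearEquiv.refl k (A ⊗[k] B)

/-- The multiplication of the smash product as a bilinear map. -/
noncomputable def mulMap : S.Carrier →ₗ[k] S.Carrier →ₗ[k] S.Carrier :=
  (TensorProduct.mk k (A ⊗[k] B) (A ⊗[k] B)).compr₂ (smashMul S.σ)

/-- The ring structure of the smash product. -/
noncomputable instance instRing : Ring S.Carrier :=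
  { S.instAddCommGroup with
    mul := fun x y => S.mulMap x y
    one := ((1 : A) ⊗ₜ[k] (1 : B) : A ⊗[k] B)
    mul_assoc := S.isSmashProduct.mul_assoc
    one_mul := S.isSmashProduct.one_mul
    mul_one := S.isSmashProduct.mul_one
    left_distrib := fun x y z => map_add (S.mulMap x) y z
    right_distrib := fun x y z => LinearMap.map_add₂ S.mulMap x y z
    zero_mul := fun x => LinearMap.map_zero₂ S.mulMap x
    mul_zero := fun x => map_zero (S.mulMap x) }

noncomputable instance instAlgebra : Algebra k S.Carrier :=
  Algebra.ofModule
    (fun r x y => by exact LinearMap.map_smul₂ S.mulMap r x y)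
    (fun r x y => by exact map_smul (S.mulMap x) r y)

/-- The coalgebra structure of the smash coproduct. -/
noncomputable instance instCoalgebra : Coalgebra k S.Carrier where
  comul := (smashComul S.τ : A ⊗[k] B →ₗ[k] (A ⊗[k] B) ⊗[k] (A ⊗[k] B))
  counit := (smashCounit k A B : A ⊗[k] B →ₗ[k] k)
  coassoc := S.isSmashCoproduct.coassoc
  rTensor_counit_comp_comul := S.isSmashCoproduct.counit_comul
  lTensor_counit_comp_comul := S.isSmashCoproduct.comul_counit

theorem map_mul_tensorTensorTensorComm {H : Type*} [Ring H] [Algebra k H] (u v : H ⊗[k] H) :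
    TensorProduct.map (LinearMap.mul' k H) (LinearMap.mul' k H)
      (TensorProduct.tensorTensorTensorComm k H H H H (u ⊗ₜ v)) = u * v := by
  induction u using TensorProduct.induction_on with
  | zero => simp
  | add u u' hu hu' => rw [TensorProduct.add_tmul, map_add, map_add, hu, hu', add_mul]
  | tmul a b =>
    induction v using TensorProduct.induction_on with
    | zero => simp
    | add v v' hv hv' => rw [TensorProduct.tmul_add, map_add, map_add, hv, hv', mul_add]
    | tmul c d => simp

theorem mul'_eq : (LinearMap.mul' k S.Carrier : S.Carrier ⊗[k] S.Carrier →ₗ[k] S.Carrier)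
    = (smashMul S.σ : (A ⊗[k] B) ⊗[k] (A ⊗[k] B) →ₗ[k] A ⊗[k] B) := by
  refine TensorProduct.ext' fun x y => ?_
  rw [LinearMap.mul'_apply]
  rfl

theorem carrier_comul_mul (x y : S.Carrier) : Coalgebra.comul (R := k) (x * y)
    = Coalgebra.comul (R := k) x * Coalgebra.comul (R := k) y := by
  rw [← map_mul_tensorTensorTensorComm, S.mul'_eq]
  exact S.comul_mul x y

/-- The smash biproduct bialgebra. -/
noncomputable instance instBialgebra : Bialgebra k S.Carrier :=
  Bialgebra.mk' k S.Carrier S.counit_one (fun {x y} => by exact S.counit_mul x y) S.comul_one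
    (fun {x y} => S.carrier_comul_mul x y)

open Coalgebra

/-- `P ∈ U ⊗ V` is normalized: `∑ ε(P¹) P² = 1` and `∑ P¹ ε(P²) = 1`. -/
def IsNormalized {U V : Type*} [Ring U] [Algebra k U] [Coalgebra k U]
    [Ring V] [Algebra k V] [Coalgebra k V] (P : U ⊗[k] V) : Prop :=
  (sw P fun P1 P2 => counit (R := k) P1 • P2) = 1 ∧
    (sw P fun P1 P2 => counit (R := k) P2 • P1) = 1

/-- The element
`∑ Z¹_τ₁τ₂ X̄¹_τ₃ X¹ ⊗ W¹ Y¹ ⊗ Z² Y²_σ₁σ₂ ε(1_τ₁σ₂ X̄²_σ₁) ⊗ 1_τ₂ 1_τ₃ X² W²`. -/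
noncomputable def alpha (W : B ⊗[k] B) (X : A ⊗[k] B) (Y : B ⊗[k] A) (Z : A ⊗[k] A) :
    S.Carrier ⊗[k] S.Carrier :=
  sw W fun W1 W2 => sw X fun X1 X2 => sw X fun X1' X2' => sw Y fun Y1 Y2 => sw Z fun Z1 Z2 =>
  sw (S.τ (Z1 ⊗ₜ 1)) fun u1 z1 =>
  sw (S.τ (z1 ⊗ₜ 1)) fun u2 z2 =>
  sw (S.τ (X1' ⊗ₜ 1)) fun u3 x3 =>
  sw (S.σ (X2' ⊗ₜ Y2)) fun y1 x1 =>
  sw (S.σ (u1 ⊗ₜ y1)) fun y2 v1 =>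
    counit (R := k) (v1 * x1) •
      (S.ofTensor ((z2 * x3 * X1) ⊗ₜ (W1 * Y1)) ⊗ₜ[k] S.ofTensor ((Z2 * y2) ⊗ₜ (u2 * u3 * X2 * W2)))

/-- The nineteen compatibility identities on `W`, `X`, `Y`, `Z`. For `τ (a ⊗ b) = ∑ b_τ ⊗ a_τ` and `σ (b ⊗ a) = ∑ a_σ ⊗ b_σ`, the
variables bound by `sw (S.τ _)` and `sw (S.σ _)` are the two tensor factors in this order. Primed
capital letters belong to a further copy of `W`, `X`, `Y` or `Z`. -/
structure FactorIdentities (W : B ⊗[k] B) (X : A ⊗[k] B) (Y : B ⊗[k] A) (Z : A ⊗[k] A) :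
    Prop where
  c1 : ∀ a : A,
    (sw W fun W1 W2 => sw X fun X1 X2 => sw X fun X1' X2' => sw Y fun Y1 Y2 => sw Z fun Z1 Z2 =>
      sw (comul (R := k) a) fun a1 a2 =>
      sw (S.τ (Z1 ⊗ₜ 1)) fun u1 z1 =>
      sw (S.τ (z1 ⊗ₜ 1)) fun u2 z2 =>
      sw (S.τ (X1' ⊗ₜ 1)) fun u3 x3 =>
      sw (S.σ (X2' ⊗ₜ Y2)) fun y1 x1 =>
      sw (S.σ (u1 ⊗ₜ y1)) fun y2 v1 =>
      sw (S.σ ((W1 * Y1) ⊗ₜ a1)) fun a1' p =>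
      sw (S.σ ((u2 * u3 * X2 * W2) ⊗ₜ a2)) fun a2' q =>
        (counit (R := k) p * counit (R := k) (v1 * x1) * counit (R := k) q) •
          ((z2 * x3 * X1 * a1') ⊗ₜ[k] (Z2 * y2 * a2')))
    = sw Z fun Z1 Z2 =>
      sw (comul (R := k) a) fun a1 a2 =>
      sw (S.τ (a2 ⊗ₜ 1)) fun u a2' =>
      sw (S.σ (u ⊗ₜ Z2)) fun z2 u' =>
        counit (R := k) u' • ((a2' * Z1) ⊗ₜ[k] (a1 * z2))
  c2 : ∀ a : A,
    (sw X fun X1 X2 => sw W fun W1 W2 =>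
      sw (S.σ (W1 ⊗ₜ a)) fun a' w1 =>
        counit (R := k) w1 • ((X1 * a') ⊗ₜ[k] (X2 * W2)))
    = sw X fun X1 X2 =>
      sw (S.τ (a ⊗ₜ 1)) fun u a' => (a' * X1) ⊗ₜ[k] (u * X2)
  c3 : ∀ a : A,
    (sw W fun W1 W2 => sw Y fun Y1 Y2 =>
      sw (S.τ (a ⊗ₜ 1)) fun u a' =>
      sw (S.σ (W2 ⊗ₜ a')) fun a'' w2 =>
        counit (R := k) w2 • ((W1 * Y1 * u) ⊗ₜ[k] (Y2 * a'')))
    = sw Y fun Y1 Y2 => Y1 ⊗ₜ[k] (a * Y2)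
  c4 : ∀ b : B,
    (sw Z fun Z1 Z2 => counit (R := k) b • (Z1 ⊗ₜ[k] Z2))
    = sw Z fun Z1 Z2 =>
      sw (comul (R := k) b) fun b1 b2 =>
      sw (S.τ (1 ⊗ₜ b1)) fun b1' e =>
      sw (S.σ (b2 ⊗ₜ Z1)) fun z1 b2' =>
      sw (S.σ (b1' ⊗ₜ Z2)) fun z2 b1'' =>
        (counit (R := k) b1'' * counit (R := k) b2') • ((e * z1) ⊗ₜ[k] z2)
  c5 : ∀ b : B,
    (sw X fun X1 X2 => X1 ⊗ₜ[k] (X2 * b))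
    = sw X fun X1 X2 =>
      sw (comul (R := k) b) fun b1 b2 =>
      sw (S.τ (1 ⊗ₜ b1)) fun b1' e =>
      sw (S.σ (b2 ⊗ₜ X1)) fun x1 b2' =>
        counit (R := k) b2' • ((e * x1) ⊗ₜ[k] (b1' * X2))
  c6 : ∀ b : B,
    (sw W fun W1 W2 => sw Y fun Y1 Y2 =>
      sw (S.τ (1 ⊗ₜ b)) fun b' e =>
      sw (S.σ (W2 ⊗ₜ e)) fun e' w2 =>
        counit (R := k) w2 • ((W1 * Y1 * b') ⊗ₜ[k] (Y2 * e')))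
    = sw Y fun Y1 Y2 =>
      sw (S.σ (b ⊗ₜ Y2)) fun y2 b' => (b' * Y1) ⊗ₜ[k] y2
  c7 : ∀ b : B,
    (sw W fun W1 W2 => sw (comul (R := k) b) fun b1 b2 => (W1 * b1) ⊗ₜ[k] (W2 * b2))
    = sw W fun W1 W2 => sw (comul (R := k) b) fun b1 b2 => (b2 * W1) ⊗ₜ[k] (b1 * W2)
  c8 :
    (sw Z fun Z1 Z2 => sw (comul (R := k) Z1) fun Z11 Z12 => Z11 ⊗ₜ[k] (Z12 ⊗ₜ[k] Z2))
    = sw X fun X1 X2 => sw Z fun Z1 Z2 => sw Z fun Z1' Z2' =>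
      sw (S.τ (Z1 ⊗ₜ 1)) fun u z1 =>
      sw (S.σ ((u * X2) ⊗ₜ Z2')) fun z2' p =>
        counit (R := k) p • ((z1 * X1) ⊗ₜ[k] (Z1' ⊗ₜ[k] (Z2 * z2')))
  c9 :
    (sw X fun X1 X2 => sw (comul (R := k) X1) fun X11 X12 => X11 ⊗ₜ[k] (X12 ⊗ₜ[k] X2))
    = sw X fun X1 X2 => sw X fun X1' X2' => X1 ⊗ₜ[k] (X1' ⊗ₜ[k] (X2 * X2'))
  c10 :
    (sw X fun X1 X2 => sw Y fun Y1 Y2 => sw Z fun Z1 Z2 =>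
      sw (S.τ (Z1 ⊗ₜ 1)) fun u z1 =>
      sw (S.τ ((z1 * X1) ⊗ₜ Y1)) fun y1 t =>
      sw (S.σ ((u * X2) ⊗ₜ Y2)) fun y2 p =>
        counit (R := k) p • (y1 ⊗ₜ[k] (t ⊗ₜ[k] (Z2 * y2))))
    = sw W fun W1 W2 => sw Y fun Y1 Y2 => sw Z fun Z1 Z2 =>
      sw (S.σ (W2 ⊗ₜ Z2)) fun z2 w2 =>
        counit (R := k) w2 • ((W1 * Y1) ⊗ₜ[k] (Z1 ⊗ₜ[k] (Y2 * z2)))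
  c11 :
    (sw W fun W1 W2 => sw X fun X1 X2 =>
      sw (S.τ (X1 ⊗ₜ W1)) fun w1 x1 => w1 ⊗ₜ[k] (x1 ⊗ₜ[k] (X2 * W2)))
    = sw W fun W1 W2 => sw X fun X1 X2 => W1 ⊗ₜ[k] (X1 ⊗ₜ[k] (W2 * X2))
  c12 :
    (sw Y fun Y1 Y2 => sw (comul (R := k) Y1) fun Y11 Y12 => Y11 ⊗ₜ[k] (Y12 ⊗ₜ[k] Y2))
    = sw W fun W1 W2 => sw Y fun Y1 Y2 => sw Y fun Y1' Y2' =>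
      sw (S.σ (W2 ⊗ₜ Y2')) fun y2' w2 =>
        counit (R := k) w2 • ((W1 * Y1) ⊗ₜ[k] (Y1' ⊗ₜ[k] (Y2 * y2')))
  c13 :
    (sw W fun W1 W2 => sw (comul (R := k) W1) fun W11 W12 => W11 ⊗ₜ[k] (W12 ⊗ₜ[k] W2))
    = sw W fun W1 W2 => sw W fun W1' W2' => W1 ⊗ₜ[k] (W1' ⊗ₜ[k] (W2 * W2'))
  c14 :
    (sw Z fun Z1 Z2 => sw (comul (R := k) Z2) fun Z21 Z22 => Z1 ⊗ₜ[k] (Z21 ⊗ₜ[k] Z22))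
    = sw X fun X1 X2 => sw Y fun Y1 Y2 => sw Z fun Z1 Z2 => sw Z fun Z1' Z2' =>
      sw (S.τ (Z1 ⊗ₜ 1)) fun u z1 =>
      sw (S.σ (Y1 ⊗ₜ Z1')) fun z1' y1 =>
      sw (S.σ ((u * X2) ⊗ₜ Y2)) fun y2 p =>
        (counit (R := k) y1 * counit (R := k) p) •
          ((z1 * X1 * z1') ⊗ₜ[k] (Z2' ⊗ₜ[k] (Z2 * y2)))
  c15 :
    (sw X fun X1 X2 => sw Z fun Z1 Z2 =>
      sw (S.τ (Z1 ⊗ₜ 1)) fun u z1 =>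
      sw (S.τ (Z2 ⊗ₜ (u * X2))) fun q z2 => (z1 * X1) ⊗ₜ[k] (q ⊗ₜ[k] z2))
    = sw X fun X1 X2 => sw X fun X1' X2' => sw Y fun Y1 Y2 => sw Z fun Z1 Z2 =>
      sw (S.τ (Z1 ⊗ₜ 1)) fun u z1 =>
      sw (S.σ (Y1 ⊗ₜ X1')) fun x1' y1 =>
      sw (S.σ ((u * X2) ⊗ₜ Y2)) fun y2 p =>
        (counit (R := k) y1 * counit (R := k) p) •
          ((z1 * X1 * x1') ⊗ₜ[k] (X2' ⊗ₜ[k] (Z2 * y2)))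
  c16 :
    (sw X fun X1 X2 => sw (comul (R := k) X2) fun X21 X22 => X1 ⊗ₜ[k] (X21 ⊗ₜ[k] X22))
    = sw W fun W1 W2 => sw X fun X1 X2 => sw X fun X1' X2' =>
      sw (S.σ (W1 ⊗ₜ X1')) fun x1' w1 =>
        counit (R := k) w1 • ((X1 * x1') ⊗ₜ[k] (X2' ⊗ₜ[k] (X2 * W2)))
  c17 :
    (sw Y fun Y1 Y2 => sw (comul (R := k) Y2) fun Y21 Y22 => Y1 ⊗ₜ[k] (Y21 ⊗ₜ[k] Y22))
    = sw Y fun Y1 Y2 => sw Y fun Y1' Y2' => (Y1 * Y1') ⊗ₜ[k] (Y2' ⊗ₜ[k] Y2)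
  c18 :
    (sw W fun W1 W2 => sw Y fun Y1 Y2 =>
      sw (S.τ (Y2 ⊗ₜ W2)) fun w2 y2 => (W1 * Y1) ⊗ₜ[k] (w2 ⊗ₜ[k] y2))
    = sw W fun W1 W2 => sw Y fun Y1 Y2 => (Y1 * W1) ⊗ₜ[k] (W2 ⊗ₜ[k] Y2)
  c19 :
    (sw W fun W1 W2 => sw (comul (R := k) W2) fun W21 W22 => W1 ⊗ₜ[k] (W21 ⊗ₜ[k] W22))
    = sw W fun W1 W2 => sw W fun W1' W2' => (W1 * W1') ⊗ₜ[k] (W2' ⊗ₜ[k] W2)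

end SmashBiproduct

end Smash

-- Write `H` for the smash biproduct. It carries projections `pA : H → A` and `pB : H → B`. Right
-- conormality of `σ` makes `pB` multiplicative, so `pB` is a bialgebra map. The map `pA` is a
-- coalgebra map and is left `H`-linear for the action `h ▶ a = pA(h a)`, so `A` is an `H`-module
-- coalgebra. Since `h = ∑ pA(h₁) pB(h₂)`, an identity in tensor powers of `H` can be recovered from
-- its images under `pA` and `pB`. In these terms C1–C7 are components of (QT4), C8–C13 of (QT2) and
-- C14–C19 of (QT3). The counits `ε_B(b_σ)` in them encode the action of `B` on `A`, and `τ` is the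
-- `pB ⊗ pA` component of the coproduct.
--
-- The components are assembled through four partial projections of `α`: `U = (id ⊗ pB)α`, `V = (pB
-- ⊗ id)α`, `Q = (pA ⊗ id)α` and `T = (id ⊗ pA)α`. There are two factorizations, `α = ∑ Q¹V¹ ⊗ Q²V²`
-- (`alpha_eq_tensorQ_tensorV`) and `α = ∑ U¹T¹ ⊗ T²U²` (`alpha_eq_tensorU_tensorT`).
--
-- For (QT2), the coproduct of `Q¹V¹` consists of the coproducts of `Q¹` and `V¹` with a `τ` between
-- them. Both `Q` and `V` satisfy the hexagon rule in the first leg, and `tensorQ_tensorV_twist`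
-- removes the `τ`; that exchange rule is proved by passing to the other factorization. (QT3) is
-- built in the same way in the second leg, with `tensorU_tensorT_twist` as its exchange rule.
--
-- For (QT4), the `id ⊗ pB`, `pB ⊗ id` and `pA ⊗ pA` components are multiplicative or module
-- conditions on `h`, so they follow from the cases `h ∈ A` and `h ∈ B`, given by C1–C7. Then (QT3)
-- glues the `pA ⊗ pA` and `id ⊗ pB` components into the `pA ⊗ id` component, and (QT2) glues that
-- with the `pB ⊗ id` component into the full identity. (QT1) follows from the normalizations and
-- the first factorization.
--
-- All computations are in Sweedler notation via `sw`. Multilinearity of the summand is what makes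
-- the notation independent of representatives; `fun_prop` discharges these side conditions.

attribute [fun_prop] IsLinearMap

/-! ### Sweedler sums: rules that need no linearity. -/

section SweedlerSums

variable {k M N M' N' P H : Type*} [CommSemiring k] [AddCommMonoid M] [AddCommMonoid N]
  [AddCommMonoid M'] [AddCommMonoid N'] [AddCommMonoid P] [Ring H]
  [Module k M] [Module k N] [Module k M'] [Module k N']

theorem sw_congr {t : M ⊗[k] N} {f g : M → N → P} (h : ∀ m n, f m n = g m n) :
    sw t f = sw t g := by
  congr
  funext m n
  exact h m n

/-- Both sums run over fixed finite sets, so no linearity is needed. In `simp` the two tensors are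
named explicitly, which directs the exchange and brings the sums into the order an identity expects.
-/
theorem sw_comm (t : M ⊗[k] N) (s : M' ⊗[k] N') (f : M → N → M' → N' → P) :
    (sw t fun a b => sw s fun c d => f a b c d) = sw s fun c d => sw t fun a b => f a b c d :=
  Finset.sum_comm

theorem sw_mul (t : M ⊗[k] N) (f : M → N → H) (h : H) :
    sw t f * h = sw t fun m n => f m n * h := Finset.sum_mul _ _ _

theorem mul_sw (t : M ⊗[k] N) (f : M → N → H) (h : H) :
    h * sw t f = sw t fun m n => h * f m n := Finset.mul_sum _ _ _

end SweedlerSums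

/-! ### Sweedler sums of multilinear expressions. -/

section SweedlerCalculus

variable {k M N P Q M' N' : Type*} [CommSemiring k] [AddCommMonoid M] [AddCommMonoid N]
  [AddCommMonoid P] [AddCommMonoid Q] [AddCommMonoid M'] [AddCommMonoid N']
  [Module k M] [Module k N] [Module k P] [Module k Q] [Module k M'] [Module k N']

namespace IsLinearMap

@[fun_prop]
theorem id_fun : IsLinearMap k (fun x : M => x) := ⟨fun _ _ => rfl, fun _ _ => rfl⟩

@[fun_prop]
theorem comp_fun {g : N → P} {f : M → N} (hg : IsLinearMap k g) (hf : IsLinearMap k f) :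
    IsLinearMap k (fun x => g (f x)) :=
  ⟨fun x y => by rw [hf.1, hg.1], fun c x => by rw [hf.2, hg.2]⟩

@[fun_prop]
theorem tmul_left {f : M → N} (hf : IsLinearMap k f) (p : P) :
    IsLinearMap k (fun x => f x ⊗ₜ[k] p) :=
  ⟨fun x y => by rw [hf.1, add_tmul], fun c x => by rw [hf.2, smul_tmul']⟩

@[fun_prop]
theorem tmul_right {f : M → N} (hf : IsLinearMap k f) (p : P) :
    IsLinearMap k (fun x => p ⊗ₜ[k] f x) :=
  ⟨fun x y => by rw [hf.1, tmul_add], fun c x => by rw [hf.2, tmul_smul]⟩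

@[fun_prop]
theorem linearMap_apply (φ : N →ₗ[k] P) {f : M → N} (hf : IsLinearMap k f) :
    IsLinearMap k (fun x => φ (f x)) :=
  ⟨fun x y => by rw [hf.1, _root_.map_add], fun c x => by rw [hf.2, _root_.map_smul]⟩

@[fun_prop]
theorem linearEquiv_apply (φ : N ≃ₗ[k] P) {f : M → N} (hf : IsLinearMap k f) :
    IsLinearMap k (fun x => φ (f x)) :=
  ⟨fun x y => by rw [hf.1, _root_.map_add], fun c x => by rw [hf.2, _root_.map_smul]⟩

@[fun_prop]
theorem linearMap_apply₂ (φ : N →ₗ[k] P →ₗ[k] Q) {f : M → N} (hf : IsLinearMap k f) (p : P) :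
    IsLinearMap k (fun x => φ (f x) p) :=
  ⟨fun x y => by rw [hf.1, LinearMap.map_add₂], fun c x => by rw [hf.2, LinearMap.map_smul₂]⟩

@[fun_prop]
theorem smul_left {f : M → k} (hf : IsLinearMap k f) (p : P) :
    IsLinearMap k (fun x => f x • p) :=
  ⟨fun x y => by rw [hf.1, add_smul], fun c x => by rw [hf.2, smul_eq_mul, mul_smul]⟩

@[fun_prop]
theorem smul_right {f : M → P} (hf : IsLinearMap k f) (c : k) :
    IsLinearMap k (fun x => c • f x) :=
  ⟨fun x y => by rw [hf.1, smul_add], fun d x => by rw [hf.2, smul_comm]⟩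

@[fun_prop]
theorem sw_right (t : M' ⊗[k] N') {f : M → M' → N' → P}
    (hf : ∀ m n, IsLinearMap k (fun x => f x m n)) : IsLinearMap k (fun x => sw t (f x)) := by
  unfold sw
  constructor
  · intro x y
    rw [← Finset.sum_add_distrib]
    exact Finset.sum_congr rfl fun p _ => (hf _ _).1 _ _
  · intro x y
    rw [Finset.smul_sum]
    exact Finset.sum_congr rfl fun p _ => (hf _ _).2 _ _

end IsLinearMap

theorem sw_eq_lift_mk₂ {f : M → N → P} (h₁ : ∀ n, IsLinearMap k (fun m => f m n))
    (h₂ : ∀ m, IsLinearMap k (fun n => f m n)) (t : M ⊗[k] N) :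
    sw t f = TensorProduct.lift (LinearMap.mk₂ k f (fun a b c => (h₁ c).1 a b)
      (fun c a b => (h₁ b).2 c a) (fun a b c => (h₂ a).1 b c) (fun c a b => (h₂ a).2 c b)) t :=
  sw_eq_lift t (LinearMap.mk₂ k f (fun a b c => (h₁ c).1 a b)
      (fun c a b => (h₁ b).2 c a) (fun a b c => (h₂ a).1 b c) (fun c a b => (h₂ a).2 c b))

-- The representation chosen for `g x` varies with `x` in no controlled way. Linearity appears only
-- after the sum is replaced by `TensorProduct.lift`, which is why `f` must be bilinear.
@[fun_prop]
theorem IsLinearMap.sw_left {g : M → M' ⊗[k] N'} {f : M' → N' → P} (hg : IsLinearMap k g)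
    (h₁ : ∀ n, IsLinearMap k (fun m => f m n)) (h₂ : ∀ m, IsLinearMap k (fun n => f m n)) :
    IsLinearMap k (fun x => sw (g x) f) := by
  constructor
  · intro x y
    simp only [sw_eq_lift_mk₂ h₁ h₂, hg.1, _root_.map_add]
  · intro x y
    simp only [sw_eq_lift_mk₂ h₁ h₂, hg.2, _root_.map_smul]

theorem sw_tmul {f : M → N → P} (h₁ : ∀ n, IsLinearMap k (fun m => f m n))
    (h₂ : ∀ m, IsLinearMap k (fun n => f m n)) (m : M) (n : N) : sw (m ⊗ₜ[k] n) f = f m n := by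
  rw [sw_eq_lift_mk₂ h₁ h₂]
  rfl

theorem sw_mk (t : M ⊗[k] N) : sw t (fun m n => m ⊗ₜ[k] n) = t := by
  have h := sw_eq_lift (k := k) t (TensorProduct.mk k M N)
  rw [TensorProduct.lift_mk] at h
  exact h

theorem map_sw {g : P → Q} (hg : IsLinearMap k g) (t : M ⊗[k] N) (f : M → N → P) :
    g (sw t f) = sw t fun m n => g (f m n) := by
  exact map_sum hg.mk' (fun p : M × N => f p.1 p.2) (TensorProduct.exists_finset t).choose

theorem sw_sw {f : M → N → P} (h₁ : ∀ n, IsLinearMap k (fun m => f m n))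
    (h₂ : ∀ m, IsLinearMap k (fun n => f m n)) (t : M' ⊗[k] N') (g : M' → N' → M ⊗[k] N) :
    sw (sw t g) f = sw t fun a b => sw (g a b) f :=
  map_sw (g := fun t => sw t f) (by fun_prop) t g

theorem sw_smul {f : M → N → P} (h₁ : ∀ n, IsLinearMap k (fun m => f m n))
    (h₂ : ∀ m, IsLinearMap k (fun n => f m n)) (c : k) (t : M ⊗[k] N) :
    sw (c • t) f = c • sw t f :=
  (IsLinearMap.sw_left (g := fun t => t) (by fun_prop) h₁ h₂).2 c t

theorem sw_map {f : P → Q → M} (h₁ : ∀ n, IsLinearMap k (fun m => f m n))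
    (h₂ : ∀ m, IsLinearMap k (fun n => f m n)) (φ : M' →ₗ[k] P) (ψ : N' →ₗ[k] Q)
    (t : M' ⊗[k] N') : sw (TensorProduct.map φ ψ t) f = sw t fun a b => f (φ a) (ψ b) := by
  conv_lhs => rw [← sw_mk t, map_sw (g := TensorProduct.map φ ψ) (by fun_prop), sw_sw h₁ h₂]
  simp (disch := fun_prop) only [TensorProduct.map_tmul, sw_tmul]

theorem tensor_ext {F G : M ⊗[k] N → P} (hF : IsLinearMap k F) (hG : IsLinearMap k G)
    (h : ∀ m n, F (m ⊗ₜ[k] n) = G (m ⊗ₜ[k] n)) (t : M ⊗[k] N) : F t = G t := by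
  have : hF.mk' F = hG.mk' G := TensorProduct.ext' h
  exact LinearMap.congr_fun this t

end SweedlerCalculus

/-! ### Linearity of products and scalar factors. -/

section SweedlerAlgebra

variable {k H M N P : Type*} [Field k] [Ring H] [Algebra k H] [AddCommGroup M] [Module k M]
  [AddCommGroup N] [Module k N] [AddCommGroup P] [Module k P]

namespace IsLinearMap

@[fun_prop]
theorem mul_left {f : M → H} (hf : IsLinearMap k f) (p : H) : IsLinearMap k (fun x => f x * p) :=
  ⟨fun x y => by rw [hf.1, add_mul], fun c x => by rw [hf.2, smul_mul_assoc]⟩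

@[fun_prop]
theorem mul_right {f : M → H} (hf : IsLinearMap k f) (p : H) : IsLinearMap k (fun x => p * f x) :=
  ⟨fun x y => by rw [hf.1, mul_add], fun c x => by rw [hf.2, mul_smul_comm]⟩

@[fun_prop]
theorem algHom_apply {K : Type*} [Ring K] [Algebra k K] (φ : H →ₐ[k] K) {f : M → H}
    (hf : IsLinearMap k f) : IsLinearMap k (fun x => φ (f x)) :=
  ⟨fun x y => by rw [hf.1, _root_.map_add], fun c x => by rw [hf.2, _root_.map_smul]⟩

end IsLinearMap

theorem smul_sw (t : M ⊗[k] N) (f : M → N → P) (c : k) :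
    c • sw t f = sw t fun m n => c • f m n := Finset.smul_sum

end SweedlerAlgebra

/-! ### Counit and coassociativity laws in Sweedler form. -/

section SweedlerCoalgebra

variable {k C P : Type*} [Field k] [AddCommGroup C] [Module k C] [Coalgebra k C]
  [AddCommGroup P] [Module k P]

open Coalgebra

theorem sw_counit_left {f : C → P} (hf : IsLinearMap k f) (c : C) :
    (sw (comul (R := k) c) fun c₁ c₂ => counit (R := k) c₁ • f c₂) = f c := by
  have h := congrArg (fun t => sw t fun (r : k) c => r • f c) (rTensor_counit_comul (R := k) c)
  simp only [LinearMap.rTensor] at h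
  simp (disch := fun_prop) only [sw_map, sw_tmul, one_smul, LinearMap.id_apply] at h
  exact h

theorem sw_counit_right {f : C → P} (hf : IsLinearMap k f) (c : C) :
    (sw (comul (R := k) c) fun c₁ c₂ => counit (R := k) c₂ • f c₁) = f c := by
  have h := congrArg (fun t => sw t fun c (r : k) => r • f c) (lTensor_counit_comul (R := k) c)
  simp only [LinearMap.lTensor] at h
  simp (disch := fun_prop) only [sw_map, sw_tmul, one_smul, LinearMap.id_apply] at h
  exact h

theorem sw_coassoc {f : C → C → C → P} (h₁ : ∀ y z, IsLinearMap k (fun x => f x y z))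
    (h₂ : ∀ x z, IsLinearMap k (fun y => f x y z)) (h₃ : ∀ x y, IsLinearMap k (fun z => f x y z))
    (c : C) :
    (sw (comul (R := k) c) fun c₁ c₂ => sw (comul (R := k) c₁) fun x y => f x y c₂)
      = sw (comul (R := k) c) fun c₁ c₂ => sw (comul (R := k) c₂) fun y z => f c₁ y z := by
  have h := congrArg (fun t => sw t fun x s => sw s fun y z => f x y z) (coassoc_apply (R := k) c)
  conv_rhs at h =>
    simp (disch := fun_prop) only [LinearMap.lTensor, sw_map, LinearMap.id_apply]
  rw [← h]
  -- Stated for an arbitrary `u`, not only an iterated coproduct, so that it can be checked on pure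
  -- tensors.
  have key : ∀ u : (C ⊗[k] C) ⊗[k] C,
      (sw (TensorProduct.assoc k C C C u) fun x s => sw s fun y z => f x y z)
        = sw u fun s z => sw s fun x y => f x y z := by
    refine tensor_ext (by fun_prop) (by fun_prop) fun s z => ?_
    revert s
    refine tensor_ext (by fun_prop) (by fun_prop) fun x y => ?_
    simp (disch := fun_prop) only [TensorProduct.assoc_tmul, sw_tmul]
  rw [key]
  simp (disch := fun_prop) only [LinearMap.rTensor, sw_map, LinearMap.id_apply]

end SweedlerCoalgebra

/-! ### Inclusions, projections and structure maps of the smash biproduct. -/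

namespace SmashBiproduct
open Coalgebra

theorem smashMul_tmul {k A B : Type*} [Field k] [Ring A] [Algebra k A] [Ring B] [Algebra k B]
    (σ : B ⊗[k] A →ₗ[k] A ⊗[k] B) (a a' : A) (b b' : B) :
    smashMul σ ((a ⊗ₜ[k] b) ⊗ₜ[k] (a' ⊗ₜ[k] b'))
      = sw (σ (b ⊗ₜ[k] a')) fun x y => (a * x) ⊗ₜ[k] (y * b') := by
  -- An arbitrary `t` replaces `σ (b ⊗ a')`, which is not a pure tensor.
  have key : ∀ t : A ⊗[k] B,
      TensorProduct.map (LinearMap.mul' k A) (LinearMap.mul' k B)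
        ((TensorProduct.tensorTensorTensorAssoc k A A B B).symm ((a ⊗ₜ[k] t) ⊗ₜ[k] b'))
      = sw t fun x y => (a * x) ⊗ₜ[k] (y * b') := by
    refine tensor_ext (by fun_prop) (by fun_prop) fun x y => ?_
    simp (disch := fun_prop) [sw_tmul]
  simp [smashMul, key]

variable {k A B : Type*} [Field k] [Ring A] [Algebra k A] [Coalgebra k A]
  [Ring B] [Algebra k B] [Coalgebra k B] (S : SmashBiproduct k A B)

/-- The inclusion `a ↦ a ⊗ 1`. -/
noncomputable def iA : A →ₗ[k] S.Carrier :=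
  S.ofTensor.toLinearMap ∘ₗ (TensorProduct.mk k A B).flip 1

/-- The inclusion `b ↦ 1 ⊗ b`. -/
noncomputable def iB : B →ₗ[k] S.Carrier :=
  S.ofTensor.toLinearMap ∘ₗ TensorProduct.mk k A B 1

/-- The projection `a ⊗ b ↦ ε(b) a`. -/
noncomputable def pA : S.Carrier →ₗ[k] A :=
  (TensorProduct.rid k A).toLinearMap ∘ₗ
    TensorProduct.map LinearMap.id (counit (R := k)) ∘ₗ S.ofTensor.symm.toLinearMap

/-- The projection `a ⊗ b ↦ ε(a) b`. -/
noncomputable def pB : S.Carrier →ₗ[k] B :=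
  (TensorProduct.lid k B).toLinearMap ∘ₗ
    TensorProduct.map (counit (R := k)) LinearMap.id ∘ₗ S.ofTensor.symm.toLinearMap

/-- The action `h ▶ a = pA (h a)` of the smash biproduct on `A`. -/
noncomputable def act : S.Carrier →ₗ[k] A →ₗ[k] A :=
  ((LinearMap.mul k S.Carrier).compl₂ S.iA).compr₂ S.pA

theorem act_def (h : S.Carrier) (a : A) : S.act h a = S.pA (h * S.iA a) := rfl

theorem ofTensor_eq_iA (a : A) : S.ofTensor (a ⊗ₜ[k] (1 : B)) = S.iA a := rfl

theorem ofTensor_eq_iB (b : B) : S.ofTensor ((1 : A) ⊗ₜ[k] b) = S.iB b := rfl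

theorem pA_ofTensor (a : A) (b : B) :
    S.pA (S.ofTensor (a ⊗ₜ[k] b)) = counit (R := k) b • a := by
  simp [pA]

theorem pB_ofTensor (a : A) (b : B) :
    S.pB (S.ofTensor (a ⊗ₜ[k] b)) = counit (R := k) a • b := by
  simp [pB]

theorem smashComul_tmul (τ : A ⊗[k] B →ₗ[k] B ⊗[k] A) (a : A) (b : B) :
    smashComul τ (a ⊗ₜ[k] b)
      = sw (comul (R := k) a) fun a₁ a₂ => sw (comul (R := k) b) fun b₁ b₂ =>
        sw (τ (a₂ ⊗ₜ[k] b₁)) fun u v => (a₁ ⊗ₜ[k] u) ⊗ₜ[k] (v ⊗ₜ[k] b₂) := by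
  have key₁ : ∀ (a₁ : A) (b₂ : B) (t : B ⊗[k] A),
      (TensorProduct.tensorTensorTensorAssoc k A B A B).symm ((a₁ ⊗ₜ[k] t) ⊗ₜ[k] b₂)
      = sw t fun u v => (a₁ ⊗ₜ[k] u) ⊗ₜ[k] (v ⊗ₜ[k] b₂) := by
    intro a₁ b₂
    refine tensor_ext (by fun_prop) (by fun_prop) fun x y => ?_
    simp (disch := fun_prop) [sw_tmul]
  have key₂ : ∀ (s : A ⊗[k] A) (t : B ⊗[k] B),
      (TensorProduct.tensorTensorTensorAssoc k A B A B).symm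
        (TensorProduct.map (TensorProduct.map LinearMap.id τ) LinearMap.id
          (TensorProduct.tensorTensorTensorAssoc k A A B B (s ⊗ₜ[k] t)))
      = sw s fun a₁ a₂ => sw t fun b₁ b₂ =>
        sw (τ (a₂ ⊗ₜ[k] b₁)) fun u v => (a₁ ⊗ₜ[k] u) ⊗ₜ[k] (v ⊗ₜ[k] b₂) := by
    intro s t
    revert s
    refine tensor_ext (by fun_prop) (by fun_prop) fun a₁ a₂ => ?_
    revert t
    refine tensor_ext (by fun_prop) (by fun_prop) fun b₁ b₂ => ?_
    simp (disch := fun_prop) [sw_tmul, key₁]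
  simp [smashComul, key₂]

theorem ofTensor_mul_ofTensor (a a' : A) (b b' : B) :
    S.ofTensor (a ⊗ₜ[k] b) * S.ofTensor (a' ⊗ₜ[k] b')
      = sw (S.σ (b ⊗ₜ[k] a')) fun x y => S.ofTensor ((a * x) ⊗ₜ[k] (y * b')) := by
  have h := congrArg S.ofTensor (smashMul_tmul S.σ a a' b b')
  rw [map_sw (g := S.ofTensor) (by fun_prop)] at h
  exact h

theorem comul_ofTensor (a : A) (b : B) :
    comul (R := k) (S.ofTensor (a ⊗ₜ[k] b))
      = sw (comul (R := k) a) fun a₁ a₂ => sw (comul (R := k) b) fun b₁ b₂ =>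
        sw (S.τ (a₂ ⊗ₜ[k] b₁)) fun u v =>
          S.ofTensor (a₁ ⊗ₜ[k] u) ⊗ₜ[k] S.ofTensor (v ⊗ₜ[k] b₂) :=
  smashComul_tmul S.τ a b

theorem counit_ofTensor (a : A) (b : B) :
    counit (R := k) (S.ofTensor (a ⊗ₜ[k] b)) = counit (R := k) a * counit (R := k) b := by
  change smashCounit k A B (a ⊗ₜ[k] b) = _
  simp [smashCounit]

theorem ofTensor_one : S.ofTensor ((1 : A) ⊗ₜ[k] (1 : B)) = 1 := rfl

/-- The left unit law of `H` applied to `a ⊗ 1`; normality of `σ` is thus a consequence and not an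
extra assumption. -/
theorem σ_one_left (a : A) : S.σ (1 ⊗ₜ[k] a) = a ⊗ₜ[k] 1 := by
  have h := S.ofTensor_mul_ofTensor 1 a 1 1
  rw [S.ofTensor_one, one_mul] at h
  simp only [one_mul, mul_one] at h
  rw [← map_sw (g := S.ofTensor) (by fun_prop), sw_mk] at h
  exact (S.ofTensor.injective h).symm

theorem σ_one_right (b : B) : S.σ (b ⊗ₜ[k] 1) = 1 ⊗ₜ[k] b := by
  have h := S.ofTensor_mul_ofTensor 1 1 b 1
  rw [S.ofTensor_one, mul_one] at h
  simp only [one_mul, mul_one] at h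
  rw [← map_sw (g := S.ofTensor) (by fun_prop), sw_mk] at h
  exact (S.ofTensor.injective h).symm

theorem ofTensor_eq (a : A) (b : B) : S.ofTensor (a ⊗ₜ[k] b) = S.iA a * S.iB b := by
  rw [← ofTensor_eq_iA, ← ofTensor_eq_iB, ofTensor_mul_ofTensor, σ_one_left]
  simp (disch := fun_prop) [sw_tmul]

theorem iA_mul (a a' : A) : S.iA (a * a') = S.iA a * S.iA a' := by
  rw [← ofTensor_eq_iA, ← ofTensor_eq_iA, ← ofTensor_eq_iA, ofTensor_mul_ofTensor, σ_one_left]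
  simp (disch := fun_prop) [sw_tmul]

theorem iB_mul (b b' : B) : S.iB (b * b') = S.iB b * S.iB b' := by
  rw [← ofTensor_eq_iB, ← ofTensor_eq_iB, ← ofTensor_eq_iB, ofTensor_mul_ofTensor, σ_one_right]
  simp (disch := fun_prop) [sw_tmul]

theorem iA_one : S.iA 1 = 1 := rfl

theorem iB_one : S.iB 1 = 1 := rfl

theorem counit_one_A (S : SmashBiproduct k A B) : counit (R := k) (1 : A) = 1 :=
  S.counital_left.counit_one

theorem counit_one_B (S : SmashBiproduct k A B) : counit (R := k) (1 : B) = 1 :=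
  S.counital_right.counit_one

theorem counit_mul_A (S : SmashBiproduct k A B) (a a' : A) :
    counit (R := k) (a * a') = counit (R := k) a * counit (R := k) a' :=
  S.counital_left.counit_mul a a'

theorem counit_mul_B (S : SmashBiproduct k A B) (b b' : B) :
    counit (R := k) (b * b') = counit (R := k) b * counit (R := k) b' :=
  S.counital_right.counit_mul b b'

theorem iB_mul_iA (b : B) (a : A) :
    S.iB b * S.iA a = sw (S.σ (b ⊗ₜ[k] a)) fun x y => S.iA x * S.iB y := by
  rw [← ofTensor_eq_iA, ← ofTensor_eq_iB, ofTensor_mul_ofTensor]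
  simp only [one_mul, mul_one, ofTensor_eq]

theorem comul_iA_mul_iB (a : A) (b : B) :
    comul (R := k) (S.iA a * S.iB b)
      = sw (comul (R := k) a) fun a₁ a₂ => sw (comul (R := k) b) fun b₁ b₂ =>
        sw (S.τ (a₂ ⊗ₜ[k] b₁)) fun u v =>
          (S.iA a₁ * S.iB u) ⊗ₜ[k] (S.iA v * S.iB b₂) := by
  simp only [← ofTensor_eq, comul_ofTensor]

theorem counit_iA_mul_iB (a : A) (b : B) :
    counit (R := k) (S.iA a * S.iB b) = counit (R := k) a * counit (R := k) b := by
  rw [← ofTensor_eq, counit_ofTensor]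

theorem pA_iA_mul_iB (a : A) (b : B) : S.pA (S.iA a * S.iB b) = counit (R := k) b • a := by
  rw [← ofTensor_eq, pA_ofTensor]

theorem pB_iA_mul_iB (a : A) (b : B) : S.pB (S.iA a * S.iB b) = counit (R := k) a • b := by
  rw [← ofTensor_eq, pB_ofTensor]

theorem pA_iA (a : A) : S.pA (S.iA a) = a := by
  rw [← ofTensor_eq_iA, pA_ofTensor, S.counit_one_B, one_smul]

theorem pB_iB (b : B) : S.pB (S.iB b) = b := by
  rw [← ofTensor_eq_iB, pB_ofTensor, S.counit_one_A, one_smul]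

theorem carrier_ext {P : Type*} [AddCommGroup P] [Module k P] {F G : S.Carrier → P}
    (hF : IsLinearMap k F) (hG : IsLinearMap k G)
    (h : ∀ a b, F (S.iA a * S.iB b) = G (S.iA a * S.iB b)) (x : S.Carrier) : F x = G x := by
  have := tensor_ext (F := fun t => F (S.ofTensor t)) (G := fun t => G (S.ofTensor t))
    (by fun_prop) (by fun_prop) (fun a b => by simp only [ofTensor_eq, h])
  exact this (S.ofTensor.symm x)

/-- The counit law of `H` at `a b`, tested on `F ∘ pB`, gives this up to counits on `a₁` and `b₂`;
the counit laws of `A` and `B` absorb them. So conormality of `τ`, unlike that of `σ`, is automatic.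
-/
theorem sw_τ_counit_right {P : Type*} [AddCommGroup P] [Module k P] {F : B → P}
    (hF : IsLinearMap k F) (a : A) (b : B) :
    (sw (S.τ (a ⊗ₜ[k] b)) fun u v => counit (R := k) v • F u) = counit (R := k) a • F b := by
  have h := sw_counit_right (k := k)
    (f := fun h : S.Carrier => F (S.pB h)) (by fun_prop) (S.iA a * S.iB b)
  simp (disch := fun_prop) only [comul_iA_mul_iB, sw_sw, sw_tmul, pB_iA_mul_iB,
    counit_iA_mul_iB, hF.2] at h
  rw [← h, ← sw_counit_left (k := k) (f := fun a => sw (S.τ (a ⊗ₜ[k] b)) fun u v =>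
    counit (R := k) v • F u) (by fun_prop) a]
  refine sw_congr fun a₁ a₂ => ?_
  rw [← sw_counit_right (k := k) (f := fun b => sw (S.τ (a₂ ⊗ₜ[k] b)) fun u v =>
    counit (R := k) v • F u) (by fun_prop) b]
  simp only [smul_sw, smul_smul, mul_comm]

theorem sw_τ_counit_left {P : Type*} [AddCommGroup P] [Module k P] {F : A → P}
    (hF : IsLinearMap k F) (a : A) (b : B) :
    (sw (S.τ (a ⊗ₜ[k] b)) fun u v => counit (R := k) u • F v) = counit (R := k) b • F a := by
  have h := sw_counit_left (k := k)
    (f := fun h : S.Carrier => F (S.pA h)) (by fun_prop) (S.iA a * S.iB b)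
  simp (disch := fun_prop) only [comul_iA_mul_iB, sw_sw, sw_tmul, pA_iA_mul_iB,
    counit_iA_mul_iB, hF.2] at h
  rw [← h, ← sw_counit_left (k := k) (f := fun a => sw (S.τ (a ⊗ₜ[k] b)) fun u v =>
    counit (R := k) u • F v) (by fun_prop) a]
  refine sw_congr fun a₁ a₂ => ?_
  rw [← sw_counit_right (k := k) (f := fun b => sw (S.τ (a₂ ⊗ₜ[k] b)) fun u v =>
    counit (R := k) u • F v) (by fun_prop) b]
  simp only [smul_sw, smul_smul, mul_comm, mul_left_comm]

/-! ### Components of the coproduct, and the action of the biproduct on `A`. -/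

section Projections

variable {P : Type*} [AddCommGroup P] [Module k P]

/-- `(pB ⊗ id) Δ (a b)`. -/
theorem sw_comul_pB_left {f : B → S.Carrier → P} (h₁ : ∀ y, IsLinearMap k (fun x => f x y))
    (h₂ : ∀ x, IsLinearMap k (fun y => f x y)) (a : A) (b : B) :
    (sw (comul (R := k) (S.iA a * S.iB b)) fun x y => f (S.pB x) y)
      = sw (comul (R := k) b) fun b₁ b₂ => sw (S.τ (a ⊗ₜ[k] b₁)) fun u v =>
        f u (S.iA v * S.iB b₂) := by
  simp (disch := fun_prop) only [comul_iA_mul_iB, sw_sw, sw_tmul, pB_iA_mul_iB, (h₁ _).2]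
  simp (disch := fun_prop) only [← smul_sw, sw_counit_left]

/-- Projecting the second leg to `B` puts a counit on the `A`-output of `τ`, and then `τ`
disappears. -/
theorem sw_comul_pB_right {f : S.Carrier → B → P} (h₁ : ∀ y, IsLinearMap k (fun x => f x y))
    (h₂ : ∀ x, IsLinearMap k (fun y => f x y)) (a : A) (b : B) :
    (sw (comul (R := k) (S.iA a * S.iB b)) fun x y => f x (S.pB y))
      = sw (comul (R := k) b) fun b₁ b₂ => f (S.iA a * S.iB b₁) b₂ := by
  simp (disch := fun_prop) only [comul_iA_mul_iB, sw_sw, sw_tmul, pB_iA_mul_iB, (h₂ _).2,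
    sw_τ_counit_right]
  simp (disch := fun_prop) only [← smul_sw, sw_counit_right]

theorem sw_comul_pA_left {f : A → S.Carrier → P} (h₁ : ∀ y, IsLinearMap k (fun x => f x y))
    (h₂ : ∀ x, IsLinearMap k (fun y => f x y)) (a : A) (b : B) :
    (sw (comul (R := k) (S.iA a * S.iB b)) fun x y => f (S.pA x) y)
      = sw (comul (R := k) a) fun a₁ a₂ => f a₁ (S.iA a₂ * S.iB b) := by
  simp (disch := fun_prop) only [comul_iA_mul_iB, sw_sw, sw_tmul, pA_iA_mul_iB, (h₁ _).2,
    sw_τ_counit_left]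
  simp (disch := fun_prop) only [sw_counit_left]

/-- `τ` is the `pB ⊗ pA` component of the coproduct. Exchange rules involving `τ` can therefore be
proved by comultiplying in `H`. -/
theorem sw_comul_pB_pA {f : B → A → P} (h₁ : ∀ y, IsLinearMap k (fun x => f x y))
    (h₂ : ∀ x, IsLinearMap k (fun y => f x y)) (a : A) (b : B) :
    (sw (comul (R := k) (S.iA a * S.iB b)) fun x y => f (S.pB x) (S.pA y))
      = sw (S.τ (a ⊗ₜ[k] b)) f := by
  rw [S.sw_comul_pB_left (f := fun x y => f x (S.pA y)) (by fun_prop) (by fun_prop)]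
  simp (disch := fun_prop) only [pA_iA_mul_iB, (h₂ _).2, ← smul_sw, sw_counit_right]

/-- `pB` is a coalgebra map. -/
theorem sw_comul_pB {f : B → B → P} (h₁ : ∀ y, IsLinearMap k (fun x => f x y))
    (h₂ : ∀ x, IsLinearMap k (fun y => f x y)) (x : S.Carrier) :
    sw (comul (R := k) (S.pB x)) f
      = sw (comul (R := k) x) fun x₁ x₂ => f (S.pB x₁) (S.pB x₂) := by
  revert x
  refine S.carrier_ext (by fun_prop) (by fun_prop) fun a b => ?_
  rw [S.sw_comul_pB_right (f := fun x y => f (S.pB x) y) (by fun_prop) (by fun_prop)]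
  simp (disch := fun_prop) only [pB_iA_mul_iB, _root_.map_smul, (h₁ _).2, ← smul_sw, sw_smul]

/-- `pA` is a coalgebra map. -/
theorem sw_comul_pA {f : A → A → P} (h₁ : ∀ y, IsLinearMap k (fun x => f x y))
    (h₂ : ∀ x, IsLinearMap k (fun y => f x y)) (x : S.Carrier) :
    sw (comul (R := k) (S.pA x)) f
      = sw (comul (R := k) x) fun x₁ x₂ => f (S.pA x₁) (S.pA x₂) := by
  revert x
  refine S.carrier_ext (by fun_prop) (by fun_prop) fun a b => ?_
  rw [S.sw_comul_pA_left (f := fun x y => f x (S.pA y)) (by fun_prop) (by fun_prop)]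
  simp (disch := fun_prop) only [pA_iA_mul_iB, _root_.map_smul, (h₂ _).2, ← smul_sw, sw_smul]

theorem sw_comul_pA_pB {f : A → B → P} (h₁ : ∀ y, IsLinearMap k (fun x => f x y))
    (h₂ : ∀ x, IsLinearMap k (fun y => f x y)) (a : A) (b : B) :
    (sw (comul (R := k) (S.iA a * S.iB b)) fun x y => f (S.pA x) (S.pB y)) = f a b := by
  rw [S.sw_comul_pB_right (f := fun x y => f (S.pA x) y) (by fun_prop) (by fun_prop)]
  simp (disch := fun_prop) only [pA_iA_mul_iB, (h₁ _).2, sw_counit_left]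

/-- Every `h` in the smash biproduct is `∑ pA(h₁) pB(h₂)`. -/
theorem sw_comul_iA_pA_iB_pB {F : S.Carrier → P} (hF : IsLinearMap k F) (x : S.Carrier) :
    (sw (comul (R := k) x) fun x₁ x₂ => F (S.iA (S.pA x₁) * S.iB (S.pB x₂))) = F x := by
  revert x
  refine S.carrier_ext (by fun_prop) (by fun_prop) fun a b => ?_
  rw [S.sw_comul_pA_pB (f := fun x y => F (S.iA x * S.iB y)) (by fun_prop) (by fun_prop)]

theorem sw_comul_mul {f : S.Carrier → S.Carrier → P} (h₁ : ∀ y, IsLinearMap k (fun x => f x y))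
    (h₂ : ∀ x, IsLinearMap k (fun y => f x y)) (x y : S.Carrier) :
    sw (comul (R := k) (x * y)) f = sw (comul (R := k) x) fun x₁ x₂ =>
      sw (comul (R := k) y) fun y₁ y₂ => f (x₁ * y₁) (x₂ * y₂) := by
  have key : ∀ s t : S.Carrier ⊗[k] S.Carrier,
      sw (s * t) f = sw s fun x₁ x₂ => sw t fun y₁ y₂ => f (x₁ * y₁) (x₂ * y₂) := by
    intro s t
    revert s
    refine tensor_ext (by fun_prop) (by fun_prop) fun x₁ x₂ => ?_
    revert t
    refine tensor_ext (by fun_prop) (by fun_prop) fun y₁ y₂ => ?_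
    simp (disch := fun_prop) only [Algebra.TensorProduct.tmul_mul_tmul, sw_tmul]
  rw [Bialgebra.comul_mul, key]

theorem counit_pA (x : S.Carrier) : counit (R := k) (S.pA x) = counit (R := k) x := by
  revert x
  refine S.carrier_ext (by fun_prop) (by fun_prop) fun a b => ?_
  rw [pA_iA_mul_iB, counit_iA_mul_iB, _root_.map_smul, smul_eq_mul, mul_comm]

theorem pA_mul_iB (x : S.Carrier) (b : B) : S.pA (x * S.iB b) = counit (R := k) b • S.pA x := by
  revert x
  refine S.carrier_ext (by fun_prop) (by fun_prop) fun a b' => ?_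
  rw [mul_assoc, ← iB_mul, pA_iA_mul_iB, pA_iA_mul_iB, S.counit_mul_B, mul_smul, smul_comm]

/-- By `pA_mul_iB`, right factors from `B` leave `pA` as scalars, so `A` is the quotient of `H` by
the left ideal generated by the kernel of `ε_B`, and `pA` is a map of left `H`-modules. -/
theorem pA_mul (x y : S.Carrier) : S.pA (x * y) = S.act x (S.pA y) := by
  revert y
  refine S.carrier_ext (by fun_prop) (by fun_prop) fun a b => ?_
  rw [← mul_assoc, pA_mul_iB, pA_iA_mul_iB, _root_.map_smul, act_def]

theorem act_mul (x y : S.Carrier) (a : A) : S.act (x * y) a = S.act x (S.act y a) := by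
  rw [act_def, mul_assoc, pA_mul, S.act_def y]

theorem act_iA (a a' : A) : S.act (S.iA a) a' = a * a' := by
  rw [act_def, ← iA_mul, pA_iA]

theorem one_act (a : A) : S.act 1 a = a := by
  rw [← S.iA_one, act_iA, one_mul]

theorem counit_act (x : S.Carrier) (a : A) :
    counit (R := k) (S.act x a) = counit (R := k) x * counit (R := k) a := by
  rw [act_def, counit_pA, Bialgebra.counit_mul, ← counit_pA S (S.iA a), pA_iA]

/-- Identifies the expression `∑ a_σ ε_B(b_σ)`, ubiquitous in C1–C19, with the action of `b` on `a`.
-/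
theorem sw_σ_counit {F : A → P} (hF : IsLinearMap k F) (b : B) (a : A) :
    (sw (S.σ (b ⊗ₜ[k] a)) fun x y => counit (R := k) y • F x) = F (S.act (S.iB b) a) := by
  rw [act_def, iB_mul_iA, map_sw (g := S.pA) (by fun_prop), map_sw hF]
  simp only [pA_iA_mul_iB, hF.2]

/-- Right conormality says precisely that `pB(b a) = ε(a) b`. Left factors from `A` and right
factors from `B` always split off, so this one case suffices. All later uses of right conormality go
through this lemma. -/
theorem pB_mul (hσ : IsRightConormal S.σ) (x y : S.Carrier) :
    S.pB (x * y) = S.pB x * S.pB y := by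
  have hpB : ∀ b a, S.pB (S.iB b * S.iA a) = counit (R := k) a • b := by
    intro b a
    have h := LinearMap.congr_fun hσ (b ⊗ₜ[k] a)
    simp only [LinearMap.comp_apply, TensorProduct.map_tmul, LinearEquiv.coe_coe,
      TensorProduct.rid_tmul, LinearMap.id_apply] at h
    rw [← h, ← ofTensor_eq_iA, ← ofTensor_eq_iB, ofTensor_mul_ofTensor]
    simp only [one_mul, mul_one]
    rw [← map_sw (g := S.ofTensor) (by fun_prop), sw_mk]
    rfl
  have hA : ∀ a x, S.pB (S.iA a * x) = counit (R := k) a • S.pB x := by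
    intro a
    refine S.carrier_ext (by fun_prop) (by fun_prop) fun a' b' => ?_
    rw [← mul_assoc, ← iA_mul, pB_iA_mul_iB, pB_iA_mul_iB, S.counit_mul_A, mul_smul]
  have hB : ∀ b x, S.pB (x * S.iB b) = S.pB x * b := by
    intro b
    refine S.carrier_ext (by fun_prop) (by fun_prop) fun a' b' => ?_
    rw [mul_assoc, ← iB_mul, pB_iA_mul_iB, pB_iA_mul_iB, smul_mul_assoc]
  revert x
  refine S.carrier_ext (by fun_prop) (by fun_prop) fun a b => ?_
  revert y
  refine S.carrier_ext (by fun_prop) (by fun_prop) fun a' b' => ?_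
  rw [mul_assoc, hA, ← mul_assoc, hB, hpB, pB_iA_mul_iB, pB_iA_mul_iB]
  simp only [smul_mul_assoc, mul_smul_comm]
  rw [smul_comm]

/-- `pB` is an algebra map, so `B` is a bialgebra. -/
theorem sw_comul_mul_B (hσ : IsRightConormal S.σ) {f : B → B → P}
    (h₁ : ∀ y, IsLinearMap k (fun x => f x y)) (h₂ : ∀ x, IsLinearMap k (fun y => f x y))
    (b b' : B) :
    sw (comul (R := k) (b * b')) f = sw (comul (R := k) b) fun b₁ b₂ =>
      sw (comul (R := k) b') fun c₁ c₂ => f (b₁ * c₁) (b₂ * c₂) := by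
  rw [← S.pB_iB (b * b'), S.sw_comul_pB h₁ h₂, iB_mul]
  simp (disch := fun_prop) only [sw_comul_mul, S.pB_mul hσ]
  conv_rhs => rw [← S.pB_iB b, ← S.pB_iB b']
  simp (disch := fun_prop) only [sw_comul_pB]

theorem sw_comul_iA_pB {f : S.Carrier → B → P} (h₁ : ∀ y, IsLinearMap k (fun x => f x y))
    (h₂ : ∀ x, IsLinearMap k (fun y => f x y)) (a : A) :
    (sw (comul (R := k) (S.iA a)) fun x y => f x (S.pB y)) = f (S.iA a) 1 := by
  have h := S.sw_comul_pB_right h₁ h₂ a 1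
  rw [S.unital_right.comul_one, sw_tmul (by fun_prop) (by fun_prop), iB_one, mul_one] at h
  exact h

theorem sw_comul_iB_pB {f : S.Carrier → B → P} (h₁ : ∀ y, IsLinearMap k (fun x => f x y))
    (h₂ : ∀ x, IsLinearMap k (fun y => f x y)) (b : B) :
    (sw (comul (R := k) (S.iB b)) fun x y => f x (S.pB y))
      = sw (comul (R := k) b) fun b₁ b₂ => f (S.iB b₁) b₂ := by
  have h := S.sw_comul_pB_right h₁ h₂ 1 b
  simpa only [iA_one, one_mul] using h

/-- `∑ (b₁ ▶ a) b₂ = b a`. -/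
theorem sw_act_iB (hσ : IsRightConormal S.σ) {F : S.Carrier → P} (hF : IsLinearMap k F)
    (b : B) (a : A) :
    (sw (comul (R := k) b) fun b₁ b₂ => F (S.iA (S.act (S.iB b₁) a) * S.iB b₂))
      = F (S.iB b * S.iA a) := by
  rw [← S.sw_comul_iA_pA_iB_pB hF]
  simp (disch := fun_prop) only [sw_comul_mul, S.pB_mul hσ]
  rw [S.sw_comul_iB_pB (f := fun x₁ x₂ => sw (comul (R := k) (S.iA a)) fun y₁ y₂ =>
    F (S.iA (S.pA (x₁ * y₁)) * S.iB (x₂ * S.pB y₂))) (by fun_prop) (by fun_prop)]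
  refine sw_congr fun b₁ b₂ => ?_
  rw [S.sw_comul_iA_pB (f := fun y₁ y₂ => F (S.iA (S.pA (S.iB b₁ * y₁)) * S.iB (b₂ * y₂)))
    (by fun_prop) (by fun_prop), mul_one, act_def]

/-- Under right conormality `σ` is determined by the action of `B` on `A`, as in an ordinary smash
product: read `sw_act_iB` back in `A ⊗ B`. -/
theorem sw_σ (hσ : IsRightConormal S.σ) {f : A → B → P} (h₁ : ∀ y, IsLinearMap k (fun x => f x y))
    (h₂ : ∀ x, IsLinearMap k (fun y => f x y)) (b : B) (a : A) :
    sw (S.σ (b ⊗ₜ[k] a)) f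
      = sw (comul (R := k) b) fun b₁ b₂ => f (S.act (S.iB b₁) a) b₂ := by
  have h := S.sw_act_iB hσ (F := fun x => sw (S.ofTensor.symm x) f) (by fun_prop) b a
  rw [iB_mul_iA] at h
  simp (disch := fun_prop) only [← ofTensor_eq, LinearEquiv.symm_apply_apply, sw_tmul] at h
  rw [h, ← map_sw (g := S.ofTensor) (by fun_prop), sw_mk, LinearEquiv.symm_apply_apply]

/-- `a ↦ τ (a ⊗ 1)` is a coaction. -/
theorem sw_τ_one_coassoc {f : B → B → A → P}
    (h₁ : ∀ y z, IsLinearMap k (fun x => f x y z)) (h₂ : ∀ x z, IsLinearMap k (fun y => f x y z))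
    (h₃ : ∀ x y, IsLinearMap k (fun z => f x y z)) (a : A) :
    (sw (S.τ (a ⊗ₜ[k] 1)) fun u v => sw (S.τ (v ⊗ₜ[k] 1)) fun u' v' => f u u' v')
      = sw (S.τ (a ⊗ₜ[k] 1)) fun u v => sw (comul (R := k) u) fun u₁ u₂ => f u₁ u₂ v := by
  conv_rhs => rw [← S.sw_comul_pB_pA (by fun_prop) (by fun_prop)]
  simp (disch := fun_prop) only [sw_comul_pB]
  rw [sw_coassoc (f := fun x y z => f (S.pB x) (S.pB y) (S.pA z)) (by fun_prop) (by fun_prop)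
    (by fun_prop), S.sw_comul_pB_left (f := fun x t => sw (comul (R := k) t) fun y z =>
      f x (S.pB y) (S.pA z)) (by fun_prop) (by fun_prop), S.unital_right.comul_one,
    sw_tmul (by fun_prop) (by fun_prop)]
  refine sw_congr fun u v => ?_
  rw [S.sw_comul_pB_pA (f := fun y z => f u y z) (by fun_prop) (by fun_prop)]

end Projections

end SmashBiproduct

/-! ### The identities C1–C19 rewritten with the action on `A`. -/

namespace SmashBiproduct
open Coalgebra

/-- `sw_σ_counit` consumes the innermost `σ` first, so its counit has to become the outermost
scalar. -/
theorem smul_rev {k P : Type*} [Field k] [AddCommGroup P] [Module k P] (c d : k) (p : P) :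
    (c * d) • p = d • c • p := by
  rw [mul_comm, mul_smul]

namespace FactorIdentities

variable {k A B : Type*} [Field k] [Ring A] [Algebra k A] [Coalgebra k A]
  [Ring B] [Algebra k B] [Coalgebra k B] {S : SmashBiproduct k A B}
  {W : B ⊗[k] B} {X : A ⊗[k] B} {Y : B ⊗[k] A} {Z : A ⊗[k] A}
  {P : Type*} [AddCommGroup P] [Module k P]

theorem twist_iA_X (hC : S.FactorIdentities W X Y Z)
    {f : A → B → P} (h₁ : ∀ y, IsLinearMap k (fun x => f x y))
    (h₂ : ∀ x, IsLinearMap k (fun y => f x y)) (a : A) :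
    (sw X fun x x' => sw W fun w w' => f (x * S.act (S.iB w) a) (x' * w'))
      = sw X fun x x' => sw (S.τ (a ⊗ₜ[k] 1)) fun u v => f (v * x) (u * x') := by
  have h := congrArg (fun t => sw t fun a b => f a b) (hC.c2 a)
  simp (disch := fun_prop) only [sw_sw, sw_tmul, sw_σ_counit] at h
  exact h

theorem twist_iA_Y (hC : S.FactorIdentities W X Y Z)
    {f : B → A → P} (h₁ : ∀ y, IsLinearMap k (fun x => f x y))
    (h₂ : ∀ x, IsLinearMap k (fun y => f x y)) (a : A) :
    (sw W fun w w' => sw Y fun y y' => sw (S.τ (a ⊗ₜ[k] 1)) fun u v =>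
      f (w * y * u) (y' * S.act (S.iB w') v))
      = sw Y fun y y' => f y (a * y') := by
  have h := congrArg (fun t => sw t fun a b => f a b) (hC.c3 a)
  simp (disch := fun_prop) only [sw_sw, sw_tmul, sw_σ_counit] at h
  exact h

theorem twist_iB_Z (hC : S.FactorIdentities W X Y Z)
    {f : A → A → P} (h₁ : ∀ y, IsLinearMap k (fun x => f x y))
    (h₂ : ∀ x, IsLinearMap k (fun y => f x y)) (b : B) :
    (sw Z fun z z' => counit (R := k) b • f z z')
      = sw Z fun z z' => sw (comul (R := k) b) fun b₁ b₂ => sw (S.τ (1 ⊗ₜ[k] b₁)) fun u v =>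
        f (v * S.act (S.iB b₂) z) (S.act (S.iB u) z') := by
  have h := congrArg (fun t => sw t fun a b => f a b) (hC.c4 b)
  simp (disch := fun_prop) only [sw_sw, sw_tmul, sw_σ_counit, sw_smul, mul_smul] at h
  exact h

theorem twist_iB_X (hC : S.FactorIdentities W X Y Z)
    {f : A → B → P} (h₁ : ∀ y, IsLinearMap k (fun x => f x y))
    (h₂ : ∀ x, IsLinearMap k (fun y => f x y)) (b : B) :
    (sw X fun x x' => f x (x' * b))
      = sw X fun x x' => sw (comul (R := k) b) fun b₁ b₂ => sw (S.τ (1 ⊗ₜ[k] b₁)) fun u v =>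
        f (v * S.act (S.iB b₂) x) (u * x') := by
  have h := congrArg (fun t => sw t fun a b => f a b) (hC.c5 b)
  simp (disch := fun_prop) only [sw_sw, sw_tmul, sw_σ_counit] at h
  exact h

theorem twist_iB_Y (hC : S.FactorIdentities W X Y Z) (hσ : IsRightConormal S.σ)
    {f : B → A → P} (h₁ : ∀ y, IsLinearMap k (fun x => f x y))
    (h₂ : ∀ x, IsLinearMap k (fun y => f x y)) (b : B) :
    (sw W fun w w' => sw Y fun y y' => sw (S.τ (1 ⊗ₜ[k] b)) fun u v =>
      f (w * y * u) (y' * S.act (S.iB w') v))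
      = sw Y fun y y' => sw (comul (R := k) b) fun b₁ b₂ => f (b₂ * y) (S.act (S.iB b₁) y') := by
  have h := congrArg (fun t => sw t fun a b => f a b) (hC.c6 b)
  simp (disch := fun_prop) only [sw_sw, sw_tmul, sw_σ_counit] at h
  simp (disch := fun_prop) only [S.sw_σ hσ] at h
  exact h

theorem twist_iB_W (hC : S.FactorIdentities W X Y Z)
    {f : B → B → P} (h₁ : ∀ y, IsLinearMap k (fun x => f x y))
    (h₂ : ∀ x, IsLinearMap k (fun y => f x y)) (b : B) :
    (sw W fun w w' => sw (comul (R := k) b) fun b₁ b₂ => f (w * b₁) (w' * b₂))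
      = sw W fun w w' => sw (comul (R := k) b) fun b₁ b₂ => f (b₂ * w) (b₁ * w') := by
  have h := congrArg (fun t => sw t fun a b => f a b) (hC.c7 b)
  simp (disch := fun_prop) only [sw_sw, sw_tmul] at h
  exact h

theorem Z_comul_left (hC : S.FactorIdentities W X Y Z)
    {f : A → A → A → P} (h₁ : ∀ y z, IsLinearMap k (fun x => f x y z))
    (h₂ : ∀ x z, IsLinearMap k (fun y => f x y z)) (h₃ : ∀ x y, IsLinearMap k (fun z => f x y z)) :
    (sw Z fun z z' => sw (comul (R := k) z) fun z₁ z₂ => f z₁ z₂ z')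
      = sw X fun x x' => sw Z fun z z' => sw Z fun t t' => sw (S.τ (z ⊗ₜ[k] 1)) fun u v =>
        f (v * x) t (z' * S.act (S.iB (u * x')) t') := by
  have h := congrArg (fun t => sw t fun a s => sw s fun b c => f a b c) hC.c8
  simp (disch := fun_prop) only [sw_sw, sw_smul, sw_tmul, sw_σ_counit] at h
  exact h

theorem X_comul_left (hC : S.FactorIdentities W X Y Z)
    {f : A → A → B → P} (h₁ : ∀ y z, IsLinearMap k (fun x => f x y z))
    (h₂ : ∀ x z, IsLinearMap k (fun y => f x y z)) (h₃ : ∀ x y, IsLinearMap k (fun z => f x y z)) :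
    (sw X fun x x' => sw (comul (R := k) x) fun x₁ x₂ => f x₁ x₂ x')
      = sw X fun x x' => sw X fun t t' => f x t (x' * t') := by
  have h := congrArg (fun t => sw t fun a s => sw s fun b c => f a b c) hC.c9
  simp (disch := fun_prop) only [sw_sw, sw_tmul] at h
  exact h

theorem YZ_twist (hC : S.FactorIdentities W X Y Z)
    {f : B → A → A → P} (h₁ : ∀ y z, IsLinearMap k (fun x => f x y z))
    (h₂ : ∀ x z, IsLinearMap k (fun y => f x y z)) (h₃ : ∀ x y, IsLinearMap k (fun z => f x y z)) :
    (sw X fun x x' => sw Y fun y y' => sw Z fun z z' => sw (S.τ (z ⊗ₜ[k] 1)) fun u v =>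
      sw (S.τ ((v * x) ⊗ₜ[k] y)) fun p q => f p q (z' * S.act (S.iB (u * x')) y'))
      = sw W fun w w' => sw Y fun y y' => sw Z fun z z' =>
        f (w * y) z (y' * S.act (S.iB w') z') := by
  have h := congrArg (fun t => sw t fun a s => sw s fun b c => f a b c) hC.c10
  simp (disch := fun_prop) only [sw_sw, sw_smul, sw_tmul, sw_σ_counit] at h
  exact h

theorem WX_twist (hC : S.FactorIdentities W X Y Z)
    {f : B → A → B → P} (h₁ : ∀ y z, IsLinearMap k (fun x => f x y z))
    (h₂ : ∀ x z, IsLinearMap k (fun y => f x y z)) (h₃ : ∀ x y, IsLinearMap k (fun z => f x y z)) :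
    (sw X fun x x' => sw W fun w w' => sw (S.τ (x ⊗ₜ[k] w)) fun u v => f u v (x' * w'))
      = sw X fun x x' => sw W fun w w' => f w x (w' * x') := by
  have h := congrArg (fun t => sw t fun a s => sw s fun b c => f a b c) hC.c11
  simp (disch := fun_prop) only [sw_sw, sw_tmul] at h
  simp only [sw_comm W X] at h
  exact h

theorem Y_comul_left (hC : S.FactorIdentities W X Y Z)
    {f : B → B → A → P} (h₁ : ∀ y z, IsLinearMap k (fun x => f x y z))
    (h₂ : ∀ x z, IsLinearMap k (fun y => f x y z)) (h₃ : ∀ x y, IsLinearMap k (fun z => f x y z)) :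
    (sw Y fun y y' => sw (comul (R := k) y) fun y₁ y₂ => f y₁ y₂ y')
      = sw W fun w w' => sw Y fun y y' => sw Y fun t t' =>
        f (w * y) t (y' * S.act (S.iB w') t') := by
  have h := congrArg (fun t => sw t fun a s => sw s fun b c => f a b c) hC.c12
  simp (disch := fun_prop) only [sw_sw, sw_smul, sw_tmul, sw_σ_counit] at h
  exact h

theorem W_comul_left (hC : S.FactorIdentities W X Y Z)
    {f : B → B → B → P} (h₁ : ∀ y z, IsLinearMap k (fun x => f x y z))
    (h₂ : ∀ x z, IsLinearMap k (fun y => f x y z)) (h₃ : ∀ x y, IsLinearMap k (fun z => f x y z)) :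
    (sw W fun w w' => sw (comul (R := k) w) fun w₁ w₂ => f w₁ w₂ w')
      = sw W fun w w' => sw W fun t t' => f w t (w' * t') := by
  have h := congrArg (fun t => sw t fun a s => sw s fun b c => f a b c) hC.c13
  simp (disch := fun_prop) only [sw_sw, sw_tmul] at h
  exact h

theorem Z_comul_right (hC : S.FactorIdentities W X Y Z)
    {f : A → A → A → P} (h₁ : ∀ y z, IsLinearMap k (fun x => f x y z))
    (h₂ : ∀ x z, IsLinearMap k (fun y => f x y z)) (h₃ : ∀ x y, IsLinearMap k (fun z => f x y z)) :
    (sw Z fun z z' => sw (comul (R := k) z') fun z₁ z₂ => f z z₁ z₂)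
      = sw X fun x x' => sw Y fun y y' => sw Z fun z z' => sw Z fun t t' =>
        sw (S.τ (z ⊗ₜ[k] 1)) fun u v =>
          f (v * x * S.act (S.iB y) t) t' (z' * S.act (S.iB (u * x')) y') := by
  have h := congrArg (fun t => sw t fun a s => sw s fun b c => f a b c) hC.c14
  simp (disch := fun_prop) only [sw_sw, sw_smul, sw_tmul, sw_σ_counit, smul_rev] at h
  exact h

theorem XZ_twist (hC : S.FactorIdentities W X Y Z)
    {f : A → B → A → P} (h₁ : ∀ y z, IsLinearMap k (fun x => f x y z))
    (h₂ : ∀ x z, IsLinearMap k (fun y => f x y z)) (h₃ : ∀ x y, IsLinearMap k (fun z => f x y z)) :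
    (sw X fun x x' => sw Z fun z z' => sw (S.τ (z ⊗ₜ[k] 1)) fun u v =>
      sw (S.τ (z' ⊗ₜ[k] (u * x'))) fun p q => f (v * x) p q)
      = sw X fun x x' => sw X fun t t' => sw Y fun y y' => sw Z fun z z' =>
        sw (S.τ (z ⊗ₜ[k] 1)) fun u v =>
          f (v * x * S.act (S.iB y) t) t' (z' * S.act (S.iB (u * x')) y') := by
  have h := congrArg (fun t => sw t fun a s => sw s fun b c => f a b c) hC.c15
  simp (disch := fun_prop) only [sw_sw, sw_smul, sw_tmul, sw_σ_counit, smul_rev] at h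
  exact h

theorem X_comul_right (hC : S.FactorIdentities W X Y Z)
    {f : A → B → B → P} (h₁ : ∀ y z, IsLinearMap k (fun x => f x y z))
    (h₂ : ∀ x z, IsLinearMap k (fun y => f x y z)) (h₃ : ∀ x y, IsLinearMap k (fun z => f x y z)) :
    (sw X fun x x' => sw (comul (R := k) x') fun x₁ x₂ => f x x₁ x₂)
      = sw X fun t t' => sw X fun x x' => sw W fun w w' =>
        f (x * S.act (S.iB w) t) t' (x' * w') := by
  have h := congrArg (fun t => sw t fun a s => sw s fun b c => f a b c) hC.c16
  simp (disch := fun_prop) only [sw_sw, sw_smul, sw_tmul, sw_σ_counit] at h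
  simp only [sw_comm W X] at h
  rw [h, sw_comm X X]

theorem Y_comul_right (hC : S.FactorIdentities W X Y Z)
    {f : B → A → A → P} (h₁ : ∀ y z, IsLinearMap k (fun x => f x y z))
    (h₂ : ∀ x z, IsLinearMap k (fun y => f x y z)) (h₃ : ∀ x y, IsLinearMap k (fun z => f x y z)) :
    (sw Y fun y y' => sw (comul (R := k) y') fun y₁ y₂ => f y y₁ y₂)
      = sw Y fun y y' => sw Y fun t t' => f (y * t) t' y' := by
  have h := congrArg (fun t => sw t fun a s => sw s fun b c => f a b c) hC.c17
  simp (disch := fun_prop) only [sw_sw, sw_tmul] at h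
  exact h

theorem WY_twist (hC : S.FactorIdentities W X Y Z)
    {f : B → B → A → P} (h₁ : ∀ y z, IsLinearMap k (fun x => f x y z))
    (h₂ : ∀ x z, IsLinearMap k (fun y => f x y z)) (h₃ : ∀ x y, IsLinearMap k (fun z => f x y z)) :
    (sw W fun w w' => sw Y fun y y' => sw (S.τ (y' ⊗ₜ[k] w')) fun u v => f (w * y) u v)
      = sw W fun w w' => sw Y fun y y' => f (y * w) w' y' := by
  have h := congrArg (fun t => sw t fun a s => sw s fun b c => f a b c) hC.c18
  simp (disch := fun_prop) only [sw_sw, sw_tmul] at h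
  exact h

theorem W_comul_right (hC : S.FactorIdentities W X Y Z)
    {f : B → B → B → P} (h₁ : ∀ y z, IsLinearMap k (fun x => f x y z))
    (h₂ : ∀ x z, IsLinearMap k (fun y => f x y z)) (h₃ : ∀ x y, IsLinearMap k (fun z => f x y z)) :
    (sw W fun w w' => sw (comul (R := k) w') fun w₁ w₂ => f w w₁ w₂)
      = sw W fun w w' => sw W fun t t' => f (w * t) t' w' := by
  have h := congrArg (fun t => sw t fun a s => sw s fun b c => f a b c) hC.c19
  simp (disch := fun_prop) only [sw_sw, sw_tmul] at h
  exact h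

theorem sw_alpha {f : S.Carrier → S.Carrier → P} (h₁ : ∀ y, IsLinearMap k (fun x => f x y))
    (h₂ : ∀ x, IsLinearMap k (fun y => f x y)) :
    sw (S.alpha W X Y Z) f
      = sw W fun w w' => sw X fun x x' => sw X fun t t' => sw Y fun y y' => sw Z fun z z' =>
        sw (S.τ (z ⊗ₜ[k] 1)) fun u v => sw (S.τ (v ⊗ₜ[k] 1)) fun p q =>
        sw (S.τ (t ⊗ₜ[k] 1)) fun r s =>
          f (S.iA (q * s * x) * S.iB (w * y))
            (S.iA (z' * S.act (S.iB u) (S.act (S.iB t') y')) * S.iB (p * r * x' * w')) := by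
  unfold alpha
  simp (disch := fun_prop) only [sw_sw, sw_tmul, S.counit_mul_B, mul_smul, sw_σ_counit,
    ofTensor_eq]

/-- C1 is the `pA ⊗ pA` component of (QT4) at `h = a`: its long left side is the two legs of `α`
acting on `a₁` and `a₂`. -/
theorem act_alpha_iA (hC : S.FactorIdentities W X Y Z) {f : A → A → P}
    (h₁ : ∀ y, IsLinearMap k (fun x => f x y)) (h₂ : ∀ x, IsLinearMap k (fun y => f x y)) (a : A) :
    (sw (S.alpha W X Y Z) fun r r' => sw (comul (R := k) a) fun a₁ a₂ =>
        f (S.act r a₁) (S.act r' a₂))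
      = sw Z fun z z' => sw (comul (R := k) a) fun a₁ a₂ => sw (S.τ (a₂ ⊗ₜ[k] 1)) fun u v =>
        f (v * z) (a₁ * S.act (S.iB u) z') := by
  have h := congrArg (fun t => sw t fun a b => f a b) (hC.c1 a)
  -- The order `q, p, v, x` is the nesting of the four `σ` sums, innermost first.
  have hs : ∀ (p v x q : k) (t : P), (p * (v * x) * q) • t = q • p • v • x • t := by
    intro p v x q t
    simp only [smul_smul]
    congr 1
    ring
  simp (disch := fun_prop) only [sw_sw, sw_smul, sw_tmul, sw_σ_counit, S.counit_mul_B, hs] at h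
  rw [← h]
  simp (disch := fun_prop) only [sw_alpha, act_mul, act_iA, sw_comm (S.τ _) (comul (R := k) a),
    sw_comm Z (comul (R := k) a), mul_assoc]

end FactorIdentities

end SmashBiproduct

/-! ### The partial projections `U`, `V`, `Q`, `T` and the two factorizations of `α`. -/

namespace SmashBiproduct
open Coalgebra

variable {k A B : Type*} [Field k] [Ring A] [Algebra k A] [Coalgebra k A]
  [Ring B] [Algebra k B] [Coalgebra k B] (S : SmashBiproduct k A B)
  (W : B ⊗[k] B) (X : A ⊗[k] B) (Y : B ⊗[k] A) (Z : A ⊗[k] A)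

/-- The element `(id ⊗ pB)(α)`. -/
noncomputable def tensorU : S.Carrier ⊗[k] B :=
  sw X fun x x' => sw W fun w w' => (S.iA x * S.iB w) ⊗ₜ[k] (x' * w')

/-- The element `(pB ⊗ id)(α)`. -/
noncomputable def tensorV : B ⊗[k] S.Carrier :=
  sw W fun w w' => sw Y fun y y' => (w * y) ⊗ₜ[k] (S.iA y' * S.iB w')

/-- The element `(pA ⊗ id)(α)`. -/
noncomputable def tensorQ : A ⊗[k] S.Carrier :=
  sw (S.tensorU W X) fun u u' => sw Z fun z z' => S.act u z ⊗ₜ[k] (S.iA z' * S.iB u')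

/-- The element `(id ⊗ pA)(α)`. -/
noncomputable def tensorT : S.Carrier ⊗[k] A :=
  sw (S.tensorQ W X Z) fun q q' => sw Y fun y y' => (S.iA q * S.iB y) ⊗ₜ[k] S.act q' y'

variable {P : Type*} [AddCommGroup P] [Module k P]

section Unfold

variable {S W X Y Z}

theorem sw_tensorU {f : S.Carrier → B → P} (h₁ : ∀ y, IsLinearMap k (fun x => f x y))
    (h₂ : ∀ x, IsLinearMap k (fun y => f x y)) :
    sw (S.tensorU W X) f
      = sw X fun x x' => sw W fun w w' => f (S.iA x * S.iB w) (x' * w') := by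
  simp (disch := fun_prop) only [tensorU, sw_sw, sw_tmul]

theorem sw_tensorV {f : B → S.Carrier → P} (h₁ : ∀ y, IsLinearMap k (fun x => f x y))
    (h₂ : ∀ x, IsLinearMap k (fun y => f x y)) :
    sw (S.tensorV W Y) f
      = sw W fun w w' => sw Y fun y y' => f (w * y) (S.iA y' * S.iB w') := by
  simp (disch := fun_prop) only [tensorV, sw_sw, sw_tmul]

theorem sw_tensorQ {f : A → S.Carrier → P} (h₁ : ∀ y, IsLinearMap k (fun x => f x y))
    (h₂ : ∀ x, IsLinearMap k (fun y => f x y)) :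
    sw (S.tensorQ W X Z) f
      = sw (S.tensorU W X) fun u u' => sw Z fun z z' => f (S.act u z) (S.iA z' * S.iB u') := by
  simp (disch := fun_prop) only [tensorQ, sw_sw, sw_tmul]

theorem sw_tensorT {f : S.Carrier → A → P} (h₁ : ∀ y, IsLinearMap k (fun x => f x y))
    (h₂ : ∀ x, IsLinearMap k (fun y => f x y)) :
    sw (S.tensorT W X Y Z) f
      = sw (S.tensorQ W X Z) fun q q' => sw Y fun y y' =>
        f (S.iA q * S.iB y) (S.act q' y') := by
  simp (disch := fun_prop) only [tensorT, sw_sw, sw_tmul]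

theorem iB_mul_iA_eq (hσ : IsRightConormal S.σ) (b : B) (a : A) :
    S.iB b * S.iA a
      = sw (comul (R := k) b) fun b₁ b₂ => S.iA (S.act (S.iB b₁) a) * S.iB b₂ :=
  (S.sw_act_iB hσ (F := fun x => x) (by fun_prop) b a).symm

theorem iB_mul_iA_mul (hσ : IsRightConormal S.σ) (b : B) (a : A) (x : S.Carrier) :
    S.iB b * (S.iA a * x)
      = sw (comul (R := k) b) fun b₁ b₂ => S.iA (S.act (S.iB b₁) a) * (S.iB b₂ * x) := by
  rw [← mul_assoc, iB_mul_iA_eq hσ, sw_mul]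
  simp only [mul_assoc]

end Unfold

namespace FactorIdentities

variable {S W X Y Z}

/-- Commuting `tensorU` past an element of `A`. -/
theorem tensorU_mul_iA (hC : S.FactorIdentities W X Y Z) (hσ : IsRightConormal S.σ)
    {f : S.Carrier → B → P} (h₁ : ∀ y, IsLinearMap k (fun x => f x y))
    (h₂ : ∀ x, IsLinearMap k (fun y => f x y)) (a : A) :
    (sw (S.tensorU W X) fun u u' => f (u * S.iA a) u')
      = sw (S.tensorU W X) fun u u' => sw W fun w w' =>
        f (S.iA (S.act u a) * S.iB w) (u' * w') := by
  simp (disch := fun_prop) only [sw_tensorU, mul_assoc, iB_mul_iA_eq hσ, mul_sw, map_sw (h₁ _),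
    hC.W_comul_left, act_mul, act_iA, iA_mul]

/-- C2 with `a = Z¹` trades the action of `W¹` for the coaction `τ (Z¹ ⊗ 1)`. This is the form in
which `Q` occurs in C8, C10, C14 and C15. -/
theorem tensorQ_eq (hC : S.FactorIdentities W X Y Z)
    {f : A → S.Carrier → P} (h₁ : ∀ y, IsLinearMap k (fun x => f x y))
    (h₂ : ∀ x, IsLinearMap k (fun y => f x y)) :
    sw (S.tensorQ W X Z) f = sw X fun x x' => sw Z fun z z' => sw (S.τ (z ⊗ₜ[k] 1)) fun u v =>
      f (v * x) (S.iA z' * S.iB (u * x')) := by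
  simp (disch := fun_prop) only [sw_tensorQ, sw_tensorU, act_mul, act_iA]
  have key := fun z' => hC.twist_iA_X (f := fun p q => f p (S.iA z' * S.iB q))
    (by fun_prop) (by fun_prop)
  simp only [sw_comm W Z, sw_comm X Z, key]

/-- Moving the `B`-part of `Q²` past `Y²` comultiplies it. C16 splits the coproduct of `X²`,
producing the second copy of `X` in `α`. C2 then turns the remaining action into `τ (X̄¹ ⊗ 1)`, and
the coaction law for `τ (Z¹ ⊗ 1)` yields the doubly twisted `Z¹`. -/
theorem alpha_eq_tensorQ_tensorV (hC : S.FactorIdentities W X Y Z) (hσ : IsRightConormal S.σ)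
    {f : S.Carrier → S.Carrier → P} (h₁ : ∀ y, IsLinearMap k (fun x => f x y))
    (h₂ : ∀ x, IsLinearMap k (fun y => f x y)) :
    sw (S.alpha W X Y Z) f = sw (S.tensorQ W X Z) fun q q' => sw (S.tensorV W Y) fun v v' =>
      f (S.iA q * S.iB v) (q' * v') := by
  simp (disch := fun_prop) only [hC.tensorQ_eq, sw_tensorV, mul_assoc, iB_mul_iA_mul hσ, mul_sw,
    map_sw (h₂ _), S.sw_comul_mul_B hσ]
  simp only [sw_comm X Z, sw_comm X (S.τ _), sw_comm Y (comul (R := k) _),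
    sw_comm W (comul (R := k) _)]
  simp (disch := fun_prop) only [sw_comm X (comul (R := k) _), hC.X_comul_right]
  have key := fun (z' v : A) (c d t' : B) => hC.twist_iA_X (f := fun p q =>
    sw W fun w w' => sw Y fun y y' => f (S.iA (v * p) * S.iB (w * y))
      (S.iA z' * (S.iA (S.act (S.iB (c * t')) y') * (S.iB (d * q) * S.iB w'))))
    (by fun_prop) (by fun_prop)
  simp only [iB_mul, mul_assoc] at key ⊢
  simp only [key]
  -- The coproduct of `1_τ` becomes a second application of `τ`, which is the pair `τ₁`, `τ₂` in
  -- `α`.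
  simp (disch := fun_prop) only [← S.sw_τ_one_coassoc, sw_alpha]
  simp only [sw_comm (S.τ _) X, sw_comm (S.τ _) W, sw_comm (S.τ _) Y, sw_comm Z X, sw_comm Z W,
    sw_comm Z Y, sw_comm X W, sw_comm X Y, iB_mul, iA_mul, mul_assoc, act_mul]
  refine sw_congr fun _ _ => sw_congr fun _ _ => ?_
  rw [sw_comm X X]

/-- The second-leg hexagon for `U`. C16 and C19 split the left side; on the right, moving `W¹` past
`X¹` comultiplies `W¹`, and C13 resolves this. -/
theorem tensorU_comul_right (hC : S.FactorIdentities W X Y Z) (hσ : IsRightConormal S.σ)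
    {f : S.Carrier → B → B → P} (h₁ : ∀ y z, IsLinearMap k (fun x => f x y z))
    (h₂ : ∀ x z, IsLinearMap k (fun y => f x y z)) (h₃ : ∀ x y, IsLinearMap k (fun z => f x y z)) :
    (sw (S.tensorU W X) fun u u' => sw (comul (R := k) u') fun u₁ u₂ => f u u₁ u₂)
      = sw (S.tensorU W X) fun u u' => sw (S.tensorU W X) fun v v' => f (u * v) v' u' := by
  simp (disch := fun_prop) only [sw_tensorU, S.sw_comul_mul_B hσ, mul_assoc, iB_mul_iA_mul hσ,
    mul_sw, map_sw (h₁ _ _)]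
  simp (disch := fun_prop) only [sw_comm W (comul (R := k) _), hC.X_comul_right, hC.W_comul_right]
  simp (disch := fun_prop) only [sw_comm W X, sw_comm X (comul (R := k) _),
    hC.W_comul_left, iA_mul, iB_mul, mul_assoc]
  exact sw_comm X X _

/-- Commuting `U¹` past `Q¹` leaves two copies of `U`, the outer one and the one inside `Q`. By
`tensorU_comul_right` they merge into one whose second leg is comultiplied, and that is what arises
when `Q²` is moved past `Y²` in the product of `Q` and `V`. -/
theorem alpha_eq_tensorU_tensorT (hC : S.FactorIdentities W X Y Z) (hσ : IsRightConormal S.σ)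
    {f : S.Carrier → S.Carrier → P} (h₁ : ∀ y, IsLinearMap k (fun x => f x y))
    (h₂ : ∀ x, IsLinearMap k (fun y => f x y)) :
    sw (S.alpha W X Y Z) f = sw (S.tensorU W X) fun u u' => sw (S.tensorT W X Y Z) fun t t' =>
      f (u * t) (S.iA t' * S.iB u') := by
  rw [hC.alpha_eq_tensorQ_tensorV hσ h₁ h₂]
  have key := fun (q' : S.Carrier) (y : B) (y' : A) => hC.tensorU_mul_iA hσ (f := fun p q =>
    f (p * S.iB y) (S.iA (S.act q' y') * S.iB q)) (by fun_prop) (by fun_prop)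
  simp (disch := fun_prop) only [sw_tensorT, sw_comm (S.tensorU W X) (S.tensorQ W X Z),
    sw_comm (S.tensorU W X) Y, ← mul_assoc, key]
  simp (disch := fun_prop) only [sw_tensorQ, sw_comm Y (S.tensorU W X),
    sw_comm Z (S.tensorU W X), ← act_mul]
  rw [sw_comm (S.tensorU W X) (S.tensorU W X), ← hC.tensorU_comul_right hσ (f := fun x b c =>
    sw Z fun z z' => sw Y fun y y' => sw W fun w w' => f (S.iA (S.act x z) * S.iB w * S.iB y)
      (S.iA (S.act (S.iA z' * S.iB b) y') * S.iB (c * w')))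
      (by fun_prop) (by fun_prop) (by fun_prop)]
  simp (disch := fun_prop) only [sw_tensorV, mul_assoc, iB_mul_iA_mul hσ, mul_sw, map_sw (h₂ _),
    act_mul, act_iA, iA_mul, iB_mul, sw_comm Y (comul (R := k) _), sw_comm W (comul (R := k) _),
    sw_comm Z (comul (R := k) _), sw_comm W Y]

end FactorIdentities

end SmashBiproduct

/-! ### The hexagon identity (QT2). -/

namespace SmashBiproduct
open Coalgebra

section Normalized

variable {k U V P : Type*} [Field k] [Ring U] [Algebra k U] [Coalgebra k U]
    [Ring V] [Algebra k V] [Coalgebra k V] [AddCommGroup P] [Module k P] {t : U ⊗[k] V}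

theorem IsNormalized.sw_counit_left (ht : IsNormalized t) {F : V → P} (hF : IsLinearMap k F) :
    (sw t fun u v => counit (R := k) u • F v) = F 1 := by
  rw [← ht.1, map_sw hF]
  simp only [hF.2]

theorem IsNormalized.sw_counit_right (ht : IsNormalized t) {F : U → P} (hF : IsLinearMap k F) :
    (sw t fun u v => counit (R := k) v • F u) = F 1 := by
  rw [← ht.2, map_sw hF]
  simp only [hF.2]

end Normalized

variable {k A B : Type*} [Field k] [Ring A] [Algebra k A] [Coalgebra k A]
  [Ring B] [Algebra k B] [Coalgebra k B] {S : SmashBiproduct k A B}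
  {W : B ⊗[k] B} {X : A ⊗[k] B} {Y : B ⊗[k] A} {Z : A ⊗[k] A}
  {P : Type*} [AddCommGroup P] [Module k P]

/-- `A` is an `H`-module coalgebra because `pA` is both a coalgebra map and `H`-linear. -/
theorem sw_comul_act {f : A → A → P} (h₁ : ∀ y, IsLinearMap k (fun x => f x y))
    (h₂ : ∀ x, IsLinearMap k (fun y => f x y)) (x : S.Carrier) (a : A) :
    sw (comul (R := k) (S.act x a)) f = sw (comul (R := k) x) fun x₁ x₂ =>
      sw (comul (R := k) a) fun a₁ a₂ => f (S.act x₁ a₁) (S.act x₂ a₂) := by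
  conv_rhs => rw [← S.pA_iA a]
  rw [act_def, S.sw_comul_pA h₁ h₂, S.sw_comul_mul (by fun_prop) (by fun_prop)]
  simp only [pA_mul]
  refine sw_congr fun x₁ x₂ => ?_
  rw [S.sw_comul_pA (f := fun a b => f (S.act x₁ a) (S.act x₂ b)) (by fun_prop) (by fun_prop)]

theorem sw_tensorU_pB (hX : IsNormalized X) {f : B → B → P}
    (h₁ : ∀ y, IsLinearMap k (fun x => f x y)) (h₂ : ∀ x, IsLinearMap k (fun y => f x y)) :
    (sw (S.tensorU W X) fun u u' => f (S.pB u) u') = sw W f := by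
  simp (disch := fun_prop) only [sw_tensorU, pB_iA_mul_iB, (h₁ _).2, ← smul_sw]
  rw [hX.sw_counit_left (F := fun x' => sw W fun w w' => f w (x' * w')) (by fun_prop)]
  simp only [one_mul]

namespace FactorIdentities

/-- C9 and C13 are the hexagons of `X` and `W`; C11 undoes the `τ` that the coproduct of `H` places
between them. -/
theorem tensorU_comul_left (hC : S.FactorIdentities W X Y Z)
    {f : S.Carrier → S.Carrier → B → P} (h₁ : ∀ y z, IsLinearMap k (fun x => f x y z))
    (h₂ : ∀ x z, IsLinearMap k (fun y => f x y z)) (h₃ : ∀ x y, IsLinearMap k (fun z => f x y z)) :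
    (sw (S.tensorU W X) fun u u' => sw (comul (R := k) u) fun u₁ u₂ => f u₁ u₂ u')
      = sw (S.tensorU W X) fun u u' => sw (S.tensorU W X) fun v v' => f u v (u' * v') := by
  simp (disch := fun_prop) only [sw_tensorU, comul_iA_mul_iB, sw_sw, sw_tmul]
  simp (disch := fun_prop) only [sw_comm W (comul (R := k) _), hC.X_comul_left, hC.W_comul_left]
  have key := fun (x : A) (x' : B) => hC.WX_twist (f := fun a b c => sw W fun p p' =>
    f (S.iA x * S.iB a) (S.iA b * S.iB p) (x' * (c * p'))) (by fun_prop) (by fun_prop)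
    (by fun_prop)
  simp only [mul_assoc, sw_comm W (S.τ _), sw_comm W X] at key ⊢
  simp only [key]

/-- C10 is the `pB ⊗ pA ⊗ pA` component of (QT2). -/
theorem tensorT_twist (hC : S.FactorIdentities W X Y Z)
    {f : B → A → A → P} (h₁ : ∀ y z, IsLinearMap k (fun x => f x y z))
    (h₂ : ∀ x z, IsLinearMap k (fun y => f x y z)) (h₃ : ∀ x y, IsLinearMap k (fun z => f x y z)) :
    (sw (S.tensorT W X Y Z) fun t t' => sw (comul (R := k) t) fun t₁ t₂ =>
        f (S.pB t₁) (S.pA t₂) t')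
      = sw (S.tensorV W Y) fun v v' => sw Z fun z z' => f v z (S.act v' z') := by
  have key := fun (q : A) (y : B) (c : A) =>
    S.sw_comul_pB_pA (f := fun a b => f a b c) (by fun_prop) (by fun_prop) q y
  simp (disch := fun_prop) only [sw_tensorT, key, hC.tensorQ_eq, act_mul, act_iA, sw_tensorV]
  simp only [sw_comm (S.τ _) Y, sw_comm Z Y]
  rw [hC.YZ_twist h₁ h₂ h₃]

theorem Y_comul_left' (hC : S.FactorIdentities W X Y Z)
    {f : B → B → A → P} (h₁ : ∀ y z, IsLinearMap k (fun x => f x y z))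
    (h₂ : ∀ x z, IsLinearMap k (fun y => f x y z)) (h₃ : ∀ x y, IsLinearMap k (fun z => f x y z)) :
    (sw Y fun y y' => sw (comul (R := k) y) fun y₁ y₂ => f y₁ y₂ y')
      = sw (S.tensorV W Y) fun v v' => sw Y fun y y' => f v y (S.act v' y') := by
  simp (disch := fun_prop) only [hC.Y_comul_left, sw_tensorV, act_mul, act_iA]

theorem Z_comul_left' (hC : S.FactorIdentities W X Y Z)
    {f : A → A → A → P} (h₁ : ∀ y z, IsLinearMap k (fun x => f x y z))
    (h₂ : ∀ x z, IsLinearMap k (fun y => f x y z)) (h₃ : ∀ x y, IsLinearMap k (fun z => f x y z)) :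
    (sw Z fun z z' => sw (comul (R := k) z) fun z₁ z₂ => f z₁ z₂ z')
      = sw (S.tensorQ W X Z) fun q q' => sw Z fun z z' => f q z (S.act q' z') := by
  simp (disch := fun_prop) only [hC.Z_comul_left, hC.tensorQ_eq, act_mul, act_iA,
    sw_comm (S.τ _) Z]

theorem tensorV_comul_left (hC : S.FactorIdentities W X Y Z) (hσ : IsRightConormal S.σ)
    {f : B → B → S.Carrier → P} (h₁ : ∀ y z, IsLinearMap k (fun x => f x y z))
    (h₂ : ∀ x z, IsLinearMap k (fun y => f x y z)) (h₃ : ∀ x y, IsLinearMap k (fun z => f x y z)) :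
    (sw (S.tensorV W Y) fun v v' => sw (comul (R := k) v) fun v₁ v₂ => f v₁ v₂ v')
      = sw (S.tensorV W Y) fun v v' => sw (S.tensorV W Y) fun w w' => f v w (v' * w') := by
  simp (disch := fun_prop) only [sw_tensorV, S.sw_comul_mul_B hσ, mul_assoc, iB_mul_iA_mul hσ,
    mul_sw, map_sw (h₃ _ _)]
  simp (disch := fun_prop) only [sw_comm Y (comul (R := k) _), sw_comm Y W,
    sw_comm W (comul (R := k) _), hC.W_comul_left, hC.W_comul_right, hC.Y_comul_left, iA_mul,
    iB_mul, mul_assoc]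
  refine sw_congr fun _ _ => ?_
  rw [sw_comm W W]

theorem tensorV_comul_right (hC : S.FactorIdentities W X Y Z)
    {f : B → S.Carrier → S.Carrier → P} (h₁ : ∀ y z, IsLinearMap k (fun x => f x y z))
    (h₂ : ∀ x z, IsLinearMap k (fun y => f x y z)) (h₃ : ∀ x y, IsLinearMap k (fun z => f x y z)) :
    (sw (S.tensorV W Y) fun v v' => sw (comul (R := k) v') fun v₁ v₂ => f v v₁ v₂)
      = sw (S.tensorV W Y) fun v v' => sw (S.tensorV W Y) fun w w' => f (v * w) w' v' := by
  simp (disch := fun_prop) only [sw_tensorV, comul_iA_mul_iB, sw_sw, sw_tmul]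
  simp (disch := fun_prop) only [sw_comm W Y, hC.W_comul_right,
    hC.Y_comul_right]
  have key := fun (w w' : B) => hC.WY_twist (f := fun a b c => sw Y fun t t' =>
    f (w * (a * t)) (S.iA t' * S.iB b) (S.iA c * S.iB w')) (by fun_prop) (by fun_prop)
    (by fun_prop)
  simp only [mul_assoc, sw_comm Y (S.τ _), sw_comm Y W] at key ⊢
  simp only [key]

/-- The coproduct acts diagonally on `U¹ ▶ Z¹`, so the hexagon of `U` and C8 apply. The copy of `U`
inside the new `Q` is then merged with the outer one by `tensorU_comul_right`. -/
theorem tensorQ_comul_left (hC : S.FactorIdentities W X Y Z) (hσ : IsRightConormal S.σ)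
    {f : A → A → S.Carrier → P} (h₁ : ∀ y z, IsLinearMap k (fun x => f x y z))
    (h₂ : ∀ x z, IsLinearMap k (fun y => f x y z)) (h₃ : ∀ x y, IsLinearMap k (fun z => f x y z)) :
    (sw (S.tensorQ W X Z) fun q q' => sw (comul (R := k) q) fun q₁ q₂ => f q₁ q₂ q')
      = sw (S.tensorQ W X Z) fun q q' => sw (S.tensorQ W X Z) fun r r' => f q r (q' * r') := by
  simp (disch := fun_prop) only [sw_tensorQ, sw_comul_act, sw_comm Z (comul (R := k) _),
    hC.tensorU_comul_left, hC.Z_comul_left']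
  rw [sw_congr fun u u' => sw_comm (S.tensorU W X) (S.tensorU W X) _]
  simp only [← act_mul]
  rw [← hC.tensorU_comul_right hσ (f := fun x b c =>
    sw (S.tensorU W X) fun v v' => sw Z fun s s' => sw Z fun z z' => 
      f (S.act x s) (S.act v z) (S.iA (S.act (S.iA s' * S.iB b) z') * S.iB (c * v')))
      (by fun_prop) (by fun_prop) (by fun_prop)]
  simp (disch := fun_prop) only [mul_assoc, iB_mul_iA_mul hσ, mul_sw, map_sw (h₃ _ _),
    act_mul, act_iA, iA_mul, iB_mul, sw_comm Z (comul (R := k) _), sw_comm Z (S.tensorU W X),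
    sw_comm (S.tensorU W X) (comul (R := k) _)]

/-- The `pB ⊗ pA ⊗ id` component of (QT2): the left side is that component of the coproduct of
`Q¹V¹`, hence of the first leg of `α`. -/
theorem tensorQ_tensorV_twist (hC : S.FactorIdentities W X Y Z) (hσ : IsRightConormal S.σ)
    (hX : IsNormalized X)
    {f : B → A → S.Carrier → P} (h₁ : ∀ y z, IsLinearMap k (fun x => f x y z))
    (h₂ : ∀ x z, IsLinearMap k (fun y => f x y z)) (h₃ : ∀ x y, IsLinearMap k (fun z => f x y z)) :
    (sw (S.tensorQ W X Z) fun q q' => sw (S.tensorV W Y) fun v v' =>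
        sw (S.τ (q ⊗ₜ[k] v)) fun a b => f a b (q' * v'))
      = sw (S.tensorV W Y) fun v v' => sw (S.tensorQ W X Z) fun q q' => f v q (v' * q') := by
  have key := fun (q : A) (v : B) (c : S.Carrier) =>
    S.sw_comul_pB_pA (f := fun a b => f a b c) (by fun_prop) (by fun_prop) q v
  simp only [← key]
  -- Passing through `α` to the factorization by `U` and `T` puts `U¹` on the left, where `pB` is
  -- multiplicative and `pA` is `H`-linear; only the hexagon of `U` and C10 are then needed.
  rw [← hC.alpha_eq_tensorQ_tensorV hσ (f := fun r r' => sw (comul (R := k) r) fun r₁ r₂ =>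
    f (S.pB r₁) (S.pA r₂) r') (by fun_prop) (by fun_prop)]
  simp (disch := fun_prop) only [hC.alpha_eq_tensorU_tensorT hσ, sw_comul_mul, S.pB_mul hσ, pA_mul,
    sw_comm (S.tensorT W X Y Z) (comul (R := k) _), hC.tensorU_comul_left]
  have key' := fun (u : B) (v : S.Carrier) (c : S.Carrier) => hC.tensorT_twist (f := fun a b d =>
    f (u * a) (S.act v b) (S.iA d * c)) (by fun_prop) (by fun_prop) (by fun_prop)
  simp only [key']
  rw [sw_tensorU_pB hX (f := fun u u' => sw (S.tensorU W X) fun v v' => sw (S.tensorV W Y)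
    fun r r' => sw Z fun z z' => f (u * r) (S.act v z) (S.iA (S.act r' z') * S.iB (u' * v')))
    (by fun_prop) (by fun_prop)]
  simp (disch := fun_prop) only [sw_tensorV, sw_tensorQ, mul_assoc, iB_mul_iA_mul hσ, mul_sw,
    map_sw (h₃ _ _), sw_comm Y (comul (R := k) _), sw_comm Z (comul (R := k) _),
    sw_comm (S.tensorU W X) (comul (R := k) _), hC.W_comul_right,
    sw_comm (S.tensorU W X) W, sw_comm (S.tensorU W X) Y, act_mul, act_iA, iA_mul, iB_mul]

theorem alpha_comul_left (hC : S.FactorIdentities W X Y Z) (hσ : IsRightConormal S.σ)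
    (hX : IsNormalized X)
    {f : S.Carrier → S.Carrier → S.Carrier → P} (h₁ : ∀ y z, IsLinearMap k (fun x => f x y z))
    (h₂ : ∀ x z, IsLinearMap k (fun y => f x y z)) (h₃ : ∀ x y, IsLinearMap k (fun z => f x y z)) :
    (sw (S.alpha W X Y Z) fun r r' => sw (comul (R := k) r) fun r₁ r₂ => f r₁ r₂ r')
      = sw (S.alpha W X Y Z) fun r r' => sw (S.alpha W X Y Z) fun s s' => f r s (r' * s') := by
  simp (disch := fun_prop) only [hC.alpha_eq_tensorQ_tensorV hσ, comul_iA_mul_iB, sw_sw, sw_tmul]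
  simp (disch := fun_prop) only [sw_comm (S.tensorV W Y) (comul (R := k) _),
    hC.tensorQ_comul_left hσ, hC.tensorV_comul_left hσ]
  have key := fun (q : A) (q' : S.Carrier) => hC.tensorQ_tensorV_twist hσ hX (f := fun a b c =>
    sw (S.tensorV W Y) fun w w' => f (S.iA q * S.iB a) (S.iA b * S.iB w) (q' * (c * w')))
    (by fun_prop) (by fun_prop) (by fun_prop)
  simp only [mul_assoc, sw_comm (S.tensorV W Y) (S.τ _)] at key ⊢
  simp only [key]

end FactorIdentities

end SmashBiproduct

/-! ### The hexagon identity (QT3). -/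

namespace SmashBiproduct
open Coalgebra

variable {k A B : Type*} [Field k] [Ring A] [Algebra k A] [Coalgebra k A]
  [Ring B] [Algebra k B] [Coalgebra k B] {S : SmashBiproduct k A B}
  {W : B ⊗[k] B} {X : A ⊗[k] B} {Y : B ⊗[k] A} {Z : A ⊗[k] A}
  {P : Type*} [AddCommGroup P] [Module k P]

theorem sw_tensorV_pA (hW : IsNormalized W) {f : B → A → P}
    (h₁ : ∀ y, IsLinearMap k (fun x => f x y)) (h₂ : ∀ x, IsLinearMap k (fun y => f x y)) :
    (sw (S.tensorV W Y) fun v v' => f v (S.pA v')) = sw Y f := by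
  simp (disch := fun_prop) only [sw_tensorV, pA_iA_mul_iB, (h₂ _).2, ← smul_sw]
  rw [hW.sw_counit_right (F := fun w => sw Y fun y y' => f (w * y) y') (by fun_prop)]
  simp only [one_mul]

theorem sw_tensorV_pB (hY : IsNormalized Y) {f : B → B → P}
    (h₁ : ∀ y, IsLinearMap k (fun x => f x y)) (h₂ : ∀ x, IsLinearMap k (fun y => f x y)) :
    (sw (S.tensorV W Y) fun v v' => f v (S.pB v')) = sw W f := by
  simp (disch := fun_prop) only [sw_tensorV, pB_iA_mul_iB, (h₂ _).2, sw_comm W Y, ← smul_sw]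
  rw [hY.sw_counit_right (F := fun y => sw W fun w w' => f (w * y) w') (by fun_prop)]
  simp only [mul_one]

namespace FactorIdentities

/-- C15, the `pA ⊗ pB ⊗ pA` component of (QT3). -/
theorem tensorU_Z_twist (hC : S.FactorIdentities W X Y Z)
    {f : A → B → A → P} (h₁ : ∀ y z, IsLinearMap k (fun x => f x y z))
    (h₂ : ∀ x z, IsLinearMap k (fun y => f x y z)) (h₃ : ∀ x y, IsLinearMap k (fun z => f x y z)) :
    (sw (S.tensorU W X) fun u u' => sw Z fun z z' => sw (S.τ (z' ⊗ₜ[k] u')) fun p q =>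
        f (S.act u z) p q)
      = sw (S.tensorT W X Y Z) fun t t' => sw X fun x x' => f (S.act t x) x' t' := by
  have key := fun (z' : A) (u' : B) (c : A) =>
    S.sw_comul_pB_pA (f := fun a b => f c a b) (by fun_prop) (by fun_prop) z' u'
  have h := (sw_tensorQ (S := S) (W := W) (X := X) (Z := Z) (f := fun q q' =>
    sw (comul (R := k) q') fun a b => f q (S.pB a) (S.pA b)) (by fun_prop) (by fun_prop)).symm
  rw [hC.tensorQ_eq (by fun_prop) (by fun_prop)] at h
  simp only [key] at h
  rw [h, hC.XZ_twist h₁ h₂ h₃]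
  simp (disch := fun_prop) only [sw_tensorT, hC.tensorQ_eq, act_mul, act_iA,
    sw_comm (S.τ _) Y, sw_comm Z Y, sw_comm (S.τ _) X, sw_comm Z X, sw_comm Y X]

/-- The component `(pA ⊗ pB ⊗ id)` of the coproduct formula in the second leg. -/
theorem tensorQ_comul_right_pB (hC : S.FactorIdentities W X Y Z) (hσ : IsRightConormal S.σ)
    {f : A → B → S.Carrier → P} (h₁ : ∀ y z, IsLinearMap k (fun x => f x y z))
    (h₂ : ∀ x z, IsLinearMap k (fun y => f x y z)) (h₃ : ∀ x y, IsLinearMap k (fun z => f x y z)) :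
    (sw (S.tensorQ W X Z) fun q q' => sw (comul (R := k) q') fun a b => f q (S.pB a) b)
      = sw (S.alpha W X Y Z) fun r r' => sw X fun x x' => f (S.act r x) x' r' := by
  have key := fun (z' : A) (u' : B) (c : A) =>
    S.sw_comul_pB_left (f := fun a b => f c a b) (by fun_prop) (by fun_prop) z' u'
  have key' := fun (u : S.Carrier) (u' : B) => hC.tensorU_Z_twist (f := fun a b c =>
    f (S.act u a) b (S.iA c * S.iB u')) (by fun_prop) (by fun_prop) (by fun_prop)
  simp (disch := fun_prop) only [sw_tensorQ, key, sw_comm Z (comul (R := k) _),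
    hC.tensorU_comul_right hσ, act_mul]
  simp (disch := fun_prop) only [key', hC.alpha_eq_tensorU_tensorT hσ, act_mul]

/-- The `id ⊗ pB ⊗ pA` component of (QT3). Here `τ` comes from the coproduct of `T²U²`; in the form
`Q²V²` the coproduct is multiplicative and the projections separate the factors. -/
theorem tensorU_tensorT_twist (hC : S.FactorIdentities W X Y Z) (hσ : IsRightConormal S.σ)
    (hW : IsNormalized W) (hY : IsNormalized Y)
    {f : S.Carrier → B → A → P} (h₁ : ∀ y z, IsLinearMap k (fun x => f x y z))
    (h₂ : ∀ x z, IsLinearMap k (fun y => f x y z)) (h₃ : ∀ x y, IsLinearMap k (fun z => f x y z)) :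
    (sw (S.tensorU W X) fun u u' => sw (S.tensorT W X Y Z) fun t t' =>
        sw (S.τ (t' ⊗ₜ[k] u')) fun a b => f (u * t) a b)
      = sw (S.tensorT W X Y Z) fun t t' => sw (S.tensorU W X) fun u u' => f (t * u) u' t' := by
  have key := fun (t' : A) (u' : B) (c : S.Carrier) =>
    S.sw_comul_pB_pA (f := fun a b => f c a b) (by fun_prop) (by fun_prop) t' u'
  simp only [← key]
  rw [← hC.alpha_eq_tensorU_tensorT hσ (f := fun r r' => sw (comul (R := k) r') fun a b =>
    f r (S.pB a) (S.pA b)) (by fun_prop) (by fun_prop),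
    hC.alpha_eq_tensorQ_tensorV hσ (by fun_prop) (by fun_prop)]
  simp (disch := fun_prop) only [sw_comul_mul, S.pB_mul hσ, pA_mul,
    sw_comm (S.tensorV W Y) (comul (R := k) _), hC.tensorV_comul_right]
  rw [hC.tensorQ_comul_right_pB hσ (f := fun a b c => sw (S.tensorV W Y) fun v v' =>
    sw (S.tensorV W Y) fun w w' => f (S.iA a * S.iB (v * w)) (b * S.pB w') (S.act c (S.pA v')))
    (by fun_prop) (by fun_prop) (by fun_prop)]
  -- Normalization collapses the two copies of `V`: under `pB` on the second leg `V` becomes `W`,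
  -- and under `pA` it becomes `Y`.
  have key₁ := fun (a : A) (b v : B) (c : A) => sw_tensorV_pB (S := S) (W := W) hY
    (f := fun w w' => f (S.iA a * S.iB (v * w)) (b * w') c) (by fun_prop) (by fun_prop)
  have key₂ := fun (a : A) (b : B) (c : S.Carrier) => sw_tensorV_pA (S := S) (Y := Y) hW
    (f := fun v v' => sw W fun w w' => f (S.iA a * S.iB (v * w)) (b * w') (S.act c v'))
    (by fun_prop) (by fun_prop)
  simp only [key₁, key₂]
  simp (disch := fun_prop) only [sw_tensorT, sw_tensorU, hC.alpha_eq_tensorQ_tensorV hσ,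
    mul_assoc, iB_mul_iA_mul hσ, mul_sw, map_sw (h₁ _ _), sw_comm W (comul (R := k) _),
    sw_comm X (comul (R := k) _), hC.Y_comul_left', act_mul, act_iA, iA_mul, iB_mul, sw_comm X Y]

theorem Z_comul_right' (hC : S.FactorIdentities W X Y Z)
    {f : A → A → A → P} (h₁ : ∀ y z, IsLinearMap k (fun x => f x y z))
    (h₂ : ∀ x z, IsLinearMap k (fun y => f x y z)) (h₃ : ∀ x y, IsLinearMap k (fun z => f x y z)) :
    (sw Z fun z z' => sw (comul (R := k) z') fun z₁ z₂ => f z z₁ z₂)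
      = sw (S.tensorT W X Y Z) fun t t' => sw Z fun z z' => f (S.act t z) z' t' := by
  simp (disch := fun_prop) only [hC.Z_comul_right, sw_tensorT, hC.tensorQ_eq, act_mul, act_iA,
    sw_comm (S.τ _) Y, sw_comm Z Y, sw_comm (S.τ _) Z]

/-- The `pA ⊗ id ⊗ id` component of (QT3). In the coproduct of `Z²U²`, C14 and `tensorU_comul_right`
split the two factors, and `tensorU_tensorT_twist` removes the `τ` between them. -/
theorem tensorQ_comul_right (hC : S.FactorIdentities W X Y Z) (hσ : IsRightConormal S.σ)
    (hW : IsNormalized W) (hY : IsNormalized Y)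
    {f : A → S.Carrier → S.Carrier → P} (h₁ : ∀ y z, IsLinearMap k (fun x => f x y z))
    (h₂ : ∀ x z, IsLinearMap k (fun y => f x y z)) (h₃ : ∀ x y, IsLinearMap k (fun z => f x y z)) :
    (sw (S.tensorQ W X Z) fun q q' => sw (comul (R := k) q') fun a b => f q a b)
      = sw (S.alpha W X Y Z) fun r r' => sw (S.tensorQ W X Z) fun q q' =>
        f (S.act r q) q' r' := by
  have key := fun (u : S.Carrier) (u' : B) => hC.tensorU_tensorT_twist hσ hW hY (f := fun a b c =>
    sw Z fun z z' => f (S.act u (S.act a z)) (S.iA z' * S.iB b) (S.iA c * S.iB u'))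
    (by fun_prop) (by fun_prop) (by fun_prop)
  simp (disch := fun_prop) only [sw_tensorQ, comul_iA_mul_iB, sw_sw, sw_tmul]
  simp (disch := fun_prop) only [hC.Z_comul_right', sw_comm Z (comul (R := k) _),
    sw_comm (S.tensorT W X Y Z) (comul (R := k) _), hC.tensorU_comul_right hσ]
  simp (disch := fun_prop) only [sw_comm Z (S.τ _),
    sw_comm (S.tensorT W X Y Z) (S.tensorU W X), act_mul,
    hC.alpha_eq_tensorU_tensorT hσ] at key ⊢
  simp only [key]

theorem alpha_comul_right (hC : S.FactorIdentities W X Y Z) (hσ : IsRightConormal S.σ)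
    (hW : IsNormalized W) (hY : IsNormalized Y)
    {f : S.Carrier → S.Carrier → S.Carrier → P} (h₁ : ∀ y z, IsLinearMap k (fun x => f x y z))
    (h₂ : ∀ x z, IsLinearMap k (fun y => f x y z)) (h₃ : ∀ x y, IsLinearMap k (fun z => f x y z)) :
    (sw (S.alpha W X Y Z) fun r r' => sw (comul (R := k) r') fun r₁ r₂ => f r r₁ r₂)
      = sw (S.alpha W X Y Z) fun r r' => sw (S.alpha W X Y Z) fun s s' => f (r * s) s' r' := by
  simp (disch := fun_prop) only [hC.alpha_eq_tensorQ_tensorV hσ, sw_comul_mul]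
  simp (disch := fun_prop) only [sw_comm (S.tensorV W Y) (comul (R := k) _),
    hC.tensorQ_comul_right hσ hW hY, hC.tensorV_comul_right]
  -- On the right side `V¹` has to pass the next `Q¹`, which comultiplies it; the first-leg hexagon
  -- of `V` matches the result with the left side.
  simp (disch := fun_prop) only [hC.alpha_eq_tensorQ_tensorV hσ, mul_assoc, iB_mul_iA_mul hσ,
    mul_sw, map_sw (h₁ _ _), sw_comm (S.tensorV W Y) (comul (R := k) _),
    sw_comm (S.tensorQ W X Z) (comul (R := k) _), hC.tensorV_comul_left hσ,
    sw_comm (S.tensorQ W X Z) (S.tensorV W Y), act_mul, act_iA, iA_mul, iB_mul]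

end FactorIdentities

end SmashBiproduct

/-! ### Counits of the partial projections, and the intertwining identity (QT4). -/

namespace SmashBiproduct
open Coalgebra

variable {k A B : Type*} [Field k] [Ring A] [Algebra k A] [Coalgebra k A]
  [Ring B] [Algebra k B] [Coalgebra k B] {S : SmashBiproduct k A B}
  {W : B ⊗[k] B} {X : A ⊗[k] B} {Y : B ⊗[k] A} {Z : A ⊗[k] A}
  {P : Type*} [AddCommGroup P] [Module k P]

section Counits

theorem sw_tensorU_counit_left (hW : IsNormalized W) (hX : IsNormalized X) {F : B → P}
    (hF : IsLinearMap k F) :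
    (sw (S.tensorU W X) fun u u' => counit (R := k) u • F u') = F 1 := by
  simp (disch := fun_prop) only [sw_tensorU, counit_iA_mul_iB, mul_smul, ← smul_sw,
    hW.sw_counit_left, mul_one, hX.sw_counit_left]

theorem sw_tensorU_counit_right (hW : IsNormalized W) (hX : IsNormalized X) {F : S.Carrier → P}
    (hF : IsLinearMap k F) :
    (sw (S.tensorU W X) fun u u' => counit (R := k) u' • F u) = F 1 := by
  simp (disch := fun_prop) only [sw_tensorU, S.counit_mul_B, mul_smul, ← smul_sw,
    hW.sw_counit_right, hX.sw_counit_right, iA_one, iB_one, mul_one]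

theorem sw_tensorV_counit_left (hW : IsNormalized W) (hY : IsNormalized Y) {F : S.Carrier → P}
    (hF : IsLinearMap k F) :
    (sw (S.tensorV W Y) fun v v' => counit (R := k) v • F v') = F 1 := by
  simp (disch := fun_prop) only [sw_tensorV, S.counit_mul_B, mul_smul, ← smul_sw,
    hY.sw_counit_left, hW.sw_counit_left, iA_one, iB_one, mul_one]

theorem sw_tensorV_counit_right (hW : IsNormalized W) (hY : IsNormalized Y) {F : B → P}
    (hF : IsLinearMap k F) :
    (sw (S.tensorV W Y) fun v v' => counit (R := k) v' • F v) = F 1 := by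
  simp (disch := fun_prop) only [sw_tensorV, counit_iA_mul_iB, smul_rev, ← smul_sw,
    hY.sw_counit_right, hW.sw_counit_right, mul_one]

theorem sw_tensorQ_counit_left (hW : IsNormalized W) (hX : IsNormalized X) (hZ : IsNormalized Z)
    {F : S.Carrier → P} (hF : IsLinearMap k F) :
    (sw (S.tensorQ W X Z) fun q q' => counit (R := k) q • F q') = F 1 := by
  simp (disch := fun_prop) only [sw_tensorQ, counit_act, mul_smul, ← smul_sw,
    hZ.sw_counit_left, sw_tensorU_counit_left hW hX, iA_one, iB_one, mul_one]

theorem sw_tensorQ_counit_right (hW : IsNormalized W) (hX : IsNormalized X) (hZ : IsNormalized Z)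
    {F : A → P} (hF : IsLinearMap k F) :
    (sw (S.tensorQ W X Z) fun q q' => counit (R := k) q' • F q) = F 1 := by
  simp (disch := fun_prop) only [sw_tensorQ, counit_iA_mul_iB, smul_rev, ← smul_sw,
    hZ.sw_counit_right, sw_tensorU_counit_right hW hX, one_act]

theorem sw_tensorT_counit_right (hW : IsNormalized W) (hX : IsNormalized X) (hY : IsNormalized Y)
    (hZ : IsNormalized Z) {F : S.Carrier → P} (hF : IsLinearMap k F) :
    (sw (S.tensorT W X Y Z) fun t t' => counit (R := k) t' • F t) = F 1 := by
  simp (disch := fun_prop) only [sw_tensorT, counit_act, mul_smul, ← smul_sw,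
    hY.sw_counit_right, sw_tensorQ_counit_right hW hX hZ, iA_one, iB_one, mul_one]

end Counits

theorem sw_comul_iA_pB_left {f : B → S.Carrier → P} (h₁ : ∀ y, IsLinearMap k (fun x => f x y))
    (h₂ : ∀ x, IsLinearMap k (fun y => f x y)) (a : A) :
    (sw (comul (R := k) (S.iA a)) fun x y => f (S.pB x) y)
      = sw (S.τ (a ⊗ₜ[k] 1)) fun u v => f u (S.iA v) := by
  have h := S.sw_comul_pB_left h₁ h₂ a 1
  rw [S.unital_right.comul_one, sw_tmul (by fun_prop) (by fun_prop)] at h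
  simpa only [iB_one, mul_one] using h

theorem sw_comul_iB_pB_left {f : B → S.Carrier → P} (h₁ : ∀ y, IsLinearMap k (fun x => f x y))
    (h₂ : ∀ x, IsLinearMap k (fun y => f x y)) (b : B) :
    (sw (comul (R := k) (S.iB b)) fun x y => f (S.pB x) y)
      = sw (comul (R := k) b) fun b₁ b₂ => sw (S.τ (1 ⊗ₜ[k] b₁)) fun u v =>
        f u (S.iA v * S.iB b₂) := by
  have h := S.sw_comul_pB_left h₁ h₂ 1 b
  simpa only [iA_one, one_mul] using h

theorem sw_comul_iA {f : S.Carrier → S.Carrier → P} (h₁ : ∀ y, IsLinearMap k (fun x => f x y))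
    (h₂ : ∀ x, IsLinearMap k (fun y => f x y)) (a : A) :
    sw (comul (R := k) (S.iA a)) f
      = sw (comul (R := k) a) fun a₁ a₂ => sw (S.τ (a₂ ⊗ₜ[k] 1)) fun u v =>
        f (S.iA a₁ * S.iB u) (S.iA v) := by
  have h := congrArg (fun t => sw t f) (S.comul_iA_mul_iB a 1)
  simp (disch := fun_prop) only [S.unital_right.comul_one, sw_sw, sw_tmul, iB_one, mul_one] at h
  exact h

theorem sw_comul_iB {f : S.Carrier → S.Carrier → P} (h₁ : ∀ y, IsLinearMap k (fun x => f x y))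
    (h₂ : ∀ x, IsLinearMap k (fun y => f x y)) (b : B) :
    sw (comul (R := k) (S.iB b)) f
      = sw (comul (R := k) b) fun b₁ b₂ => sw (S.τ (1 ⊗ₜ[k] b₁)) fun u v =>
        f (S.iB u) (S.iA v * S.iB b₂) := by
  have h := congrArg (fun t => sw t f) (S.comul_iA_mul_iB 1 b)
  simp (disch := fun_prop) only [S.unital_left.comul_one, sw_sw, sw_tmul, iA_one, one_mul] at h
  exact h

theorem mul_iA_eq (hσ : IsRightConormal S.σ) (x : S.Carrier) (a : A) :
    x * S.iA a = sw (comul (R := k) x) fun x₁ x₂ => S.iA (S.act x₁ a) * S.iB (S.pB x₂) := by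
  rw [← S.sw_comul_iA_pA_iB_pB (F := fun x => x) (by fun_prop) (x * S.iA a),
    S.sw_comul_mul (by fun_prop) (by fun_prop)]
  simp only [S.pB_mul hσ, pA_mul]
  refine sw_congr fun x₁ x₂ => ?_
  rw [S.sw_comul_iA_pB (f := fun y₁ y₂ => S.iA (S.act x₁ (S.pA y₁)) * S.iB (S.pB x₂ * y₂))
    (by fun_prop) (by fun_prop), pA_iA, mul_one]

namespace FactorIdentities

theorem sw_alpha_pB_left (hC : S.FactorIdentities W X Y Z) (hσ : IsRightConormal S.σ)
    (hW : IsNormalized W) (hX : IsNormalized X) (hZ : IsNormalized Z)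
    {f : B → S.Carrier → P} (h₁ : ∀ y, IsLinearMap k (fun x => f x y))
    (h₂ : ∀ x, IsLinearMap k (fun y => f x y)) :
    (sw (S.alpha W X Y Z) fun r r' => f (S.pB r) r') = sw (S.tensorV W Y) f := by
  simp (disch := fun_prop) only [hC.alpha_eq_tensorQ_tensorV hσ, pB_iA_mul_iB, (h₁ _).2, ← smul_sw]
  rw [sw_tensorQ_counit_left hW hX hZ (F := fun q' => sw (S.tensorV W Y) fun v v' =>
    f v (q' * v')) (by fun_prop)]
  simp only [one_mul]

theorem sw_alpha_pB_right (hC : S.FactorIdentities W X Y Z) (hσ : IsRightConormal S.σ)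
    (hW : IsNormalized W) (hX : IsNormalized X) (hY : IsNormalized Y) (hZ : IsNormalized Z)
    {f : S.Carrier → B → P} (h₁ : ∀ y, IsLinearMap k (fun x => f x y))
    (h₂ : ∀ x, IsLinearMap k (fun y => f x y)) :
    (sw (S.alpha W X Y Z) fun r r' => f r (S.pB r')) = sw (S.tensorU W X) f := by
  simp (disch := fun_prop) only [hC.alpha_eq_tensorU_tensorT hσ, pB_iA_mul_iB, (h₂ _).2,
    sw_tensorT_counit_right hW hX hY hZ, mul_one]

/-- The `id ⊗ pB` component of (QT4). As `pB` and the coproduct are multiplicative, it passes from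
`a` and `b` to `a b`. The case of `A` is C2; the case of `B` combines C5 and C7. -/
theorem tensorU_mul_comul (hC : S.FactorIdentities W X Y Z) (hσ : IsRightConormal S.σ)
    {f : S.Carrier → B → P} (h₁ : ∀ y, IsLinearMap k (fun x => f x y))
    (h₂ : ∀ x, IsLinearMap k (fun y => f x y)) (h : S.Carrier) :
    (sw (S.tensorU W X) fun u u' => sw (comul (R := k) h) fun p q => f (u * p) (u' * S.pB q))
      = sw (S.tensorU W X) fun u u' => sw (comul (R := k) h) fun p q =>
        f (q * u) (S.pB p * u') := by
  have hA : ∀ {f : S.Carrier → B → P} (_ : ∀ y, IsLinearMap k (fun x => f x y))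
      (_ : ∀ x, IsLinearMap k (fun y => f x y)) (a : A),
      (sw (S.tensorU W X) fun u u' => sw (comul (R := k) (S.iA a)) fun p q =>
        f (u * p) (u' * S.pB q))
      = sw (S.tensorU W X) fun u u' => sw (comul (R := k) (S.iA a)) fun p q =>
        f (q * u) (S.pB p * u') := by
    intro f h₁ h₂ a
    have k₁ := fun (u : S.Carrier) (u' : B) => S.sw_comul_iA_pB
      (f := fun p q => f (u * p) (u' * q)) (by fun_prop) (by fun_prop) a
    have k₂ := fun (u : S.Carrier) (u' : B) => sw_comul_iA_pB_left (S := S)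
      (f := fun p q => f (q * u) (p * u')) (by fun_prop) (by fun_prop) a
    simp only [k₁, k₂, mul_one]
    rw [hC.tensorU_mul_iA hσ h₁ h₂]
    have key := hC.twist_iA_X (f := fun c d => sw W fun w w' => f (S.iA c * S.iB w) (d * w'))
      (by fun_prop) (by fun_prop) a
    simp only [iA_mul, mul_assoc] at key
    simp (disch := fun_prop) only [sw_tensorU, act_mul, act_iA, key, sw_comm W (S.τ _), iA_mul,
      mul_assoc]
  have hB : ∀ {f : S.Carrier → B → P} (_ : ∀ y, IsLinearMap k (fun x => f x y))
      (_ : ∀ x, IsLinearMap k (fun y => f x y)) (b : B),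
      (sw (S.tensorU W X) fun u u' => sw (comul (R := k) (S.iB b)) fun p q =>
        f (u * p) (u' * S.pB q))
      = sw (S.tensorU W X) fun u u' => sw (comul (R := k) (S.iB b)) fun p q =>
        f (q * u) (S.pB p * u') := by
    intro f h₁ h₂ b
    have k₁ := fun (u : S.Carrier) (u' : B) => S.sw_comul_iB_pB
      (f := fun p q => f (u * p) (u' * q)) (by fun_prop) (by fun_prop) b
    have k₂ := fun (u : S.Carrier) (u' : B) => sw_comul_iB_pB_left (S := S)
      (f := fun p q => f (q * u) (p * u')) (by fun_prop) (by fun_prop) b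
    have k₃ := fun (x : A) (x' : B) => hC.twist_iB_W
      (f := fun w w' => f (S.iA x * S.iB w) (x' * w')) (by fun_prop) (by fun_prop) b
    have k₄ := fun (b₂ : B) => hC.twist_iB_X (f := fun x x' => sw W fun w w' =>
      f (S.iA x * S.iB (b₂ * w)) (x' * w')) (by fun_prop) (by fun_prop)
    simp only [iB_mul, iA_mul, mul_assoc] at k₃ k₄
    simp (disch := fun_prop) only [k₁, k₂, sw_tensorU, mul_assoc, k₃]
    simp only [sw_comm W (comul (R := k) _), sw_comm X (comul (R := k) _), k₄]
    simp (disch := fun_prop) only [iB_mul_iA_mul hσ, mul_sw, map_sw (h₁ _),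
      sw_comm X (comul (R := k) _), sw_coassoc, sw_comm W (S.τ _),
      sw_comm (S.τ _) (comul (R := k) _), sw_comm W (comul (R := k) _)]
  revert h
  refine S.carrier_ext (by fun_prop) (by fun_prop) fun a b => ?_
  simp (disch := fun_prop) only [sw_comul_mul, S.pB_mul hσ]
  have k₁ := hA (f := fun x y => sw (comul (R := k) (S.iB b)) fun r s =>
    f (x * r) (y * S.pB s)) (by fun_prop) (by fun_prop) a
  have k₂ := fun (q : S.Carrier) (p : B) => hB (f := fun x y => f (q * x) (p * y))
    (by fun_prop) (by fun_prop) b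
  simp only [mul_assoc] at k₁ k₂ ⊢
  rw [k₁]
  simp only [sw_comm (S.tensorU W X) (comul (R := k) (S.iA a)), k₂]

/-- The `pB ⊗ id` component of (QT4), again by multiplicativity: C3 for `A`, and C6 with C7 for `B`.
-/
theorem tensorV_mul_comul (hC : S.FactorIdentities W X Y Z) (hσ : IsRightConormal S.σ)
    {f : B → S.Carrier → P} (h₁ : ∀ y, IsLinearMap k (fun x => f x y))
    (h₂ : ∀ x, IsLinearMap k (fun y => f x y)) (h : S.Carrier) :
    (sw (S.tensorV W Y) fun v v' => sw (comul (R := k) h) fun p q => f (v * S.pB p) (v' * q))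
      = sw (S.tensorV W Y) fun v v' => sw (comul (R := k) h) fun p q =>
        f (S.pB q * v) (p * v') := by
  have hA : ∀ {f : B → S.Carrier → P} (_ : ∀ y, IsLinearMap k (fun x => f x y))
      (_ : ∀ x, IsLinearMap k (fun y => f x y)) (a : A),
      (sw (S.tensorV W Y) fun v v' => sw (comul (R := k) (S.iA a)) fun p q =>
        f (v * S.pB p) (v' * q))
      = sw (S.tensorV W Y) fun v v' => sw (comul (R := k) (S.iA a)) fun p q =>
        f (S.pB q * v) (p * v') := by
    intro f h₁ h₂ a
    have k₁ := fun (v : B) (v' : S.Carrier) => sw_comul_iA_pB_left (S := S)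
      (f := fun p q => f (v * p) (v' * q)) (by fun_prop) (by fun_prop) a
    have k₂ := fun (v : B) (v' : S.Carrier) => S.sw_comul_iA_pB
      (f := fun p q => f (q * v) (p * v')) (by fun_prop) (by fun_prop) a
    have k₃ := fun (w w' : B) => hC.twist_iA_Y (f := fun y y' => f (w * y) (S.iA y' * S.iB w'))
      (by fun_prop) (by fun_prop) a
    simp only [iA_mul, mul_assoc] at k₃
    simp (disch := fun_prop) only [k₁, k₂, sw_tensorV, one_mul, mul_assoc, iB_mul_iA_eq hσ,
      mul_sw, map_sw (h₂ _), sw_comm Y (comul (R := k) _), sw_comm (S.τ _) (comul (R := k) _),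
      hC.W_comul_right, k₃]
  have hB : ∀ {f : B → S.Carrier → P} (_ : ∀ y, IsLinearMap k (fun x => f x y))
      (_ : ∀ x, IsLinearMap k (fun y => f x y)) (b : B),
      (sw (S.tensorV W Y) fun v v' => sw (comul (R := k) (S.iB b)) fun p q =>
        f (v * S.pB p) (v' * q))
      = sw (S.tensorV W Y) fun v v' => sw (comul (R := k) (S.iB b)) fun p q =>
        f (S.pB q * v) (p * v') := by
    intro f h₁ h₂ b
    have k₁ := fun (v : B) (v' : S.Carrier) => sw_comul_iB_pB_left (S := S)
      (f := fun p q => f (v * p) (v' * q)) (by fun_prop) (by fun_prop) b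
    have k₂ := fun (v : B) (v' : S.Carrier) => S.sw_comul_iB_pB
      (f := fun p q => f (q * v) (p * v')) (by fun_prop) (by fun_prop) b
    have k₃ := fun (w w' b₂ : B) => hC.twist_iB_Y hσ (f := fun y y' =>
      f (w * y) (S.iA y' * (S.iB w' * S.iB b₂))) (by fun_prop) (by fun_prop)
    have k₄ := fun (b₁ : B) (y : B) (y' : A) => hC.twist_iB_W (f := fun w w' =>
      f (w * y) (S.iA (S.act (S.iB b₁) y') * S.iB w')) (by fun_prop) (by fun_prop)
    simp only [iA_mul, iB_mul, mul_assoc] at k₃ k₄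
    simp (disch := fun_prop) only [k₁, k₂, sw_tensorV, mul_assoc, iB_mul_iA_mul hσ,
      mul_sw, map_sw (h₂ _)]
    simp (disch := fun_prop) only [sw_comm (S.τ _) (comul (R := k) _),
      sw_comm Y (comul (R := k) _), sw_comm W (comul (R := k) b), hC.W_comul_right, mul_assoc]
    simp only [k₃]
    simp (disch := fun_prop) only [sw_comm Y (comul (R := k) _), sw_comm W (comul (R := k) _),
      sw_coassoc] at k₄ ⊢
    simp only [sw_comm W Y, sw_comm (comul (R := k) _) Y, k₄]
  revert h
  refine S.carrier_ext (by fun_prop) (by fun_prop) fun a b => ?_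
  simp (disch := fun_prop) only [sw_comul_mul, S.pB_mul hσ]
  have k₁ := hA (f := fun x y => sw (comul (R := k) (S.iB b)) fun r s =>
    f (x * S.pB r) (y * s)) (by fun_prop) (by fun_prop) a
  have k₂ := fun (q : B) (p : S.Carrier) => hB (f := fun x y => f (q * x) (p * y))
    (by fun_prop) (by fun_prop) b
  simp only [mul_assoc] at k₁ k₂ ⊢
  rw [k₁]
  simp only [sw_comm (S.tensorV W Y) (comul (R := k) (S.iA a)), k₂]

/-- The `pA ⊗ pA` component of (QT4). At `h = a b` the factor `b` leaves the left side as `ε(b)`; C4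
does the same on the right, and C1 settles the rest. -/
theorem alpha_act_comul (hC : S.FactorIdentities W X Y Z)
    {f : A → A → P} (h₁ : ∀ y, IsLinearMap k (fun x => f x y))
    (h₂ : ∀ x, IsLinearMap k (fun y => f x y)) (h : S.Carrier) :
    (sw (S.alpha W X Y Z) fun r r' => sw (comul (R := k) h) fun p q =>
        f (S.act r (S.pA p)) (S.act r' (S.pA q)))
      = sw Z fun z z' => sw (comul (R := k) h) fun p q => f (S.act q z) (S.act p z') := by
  have k₁ := fun (r r' : S.Carrier) => S.sw_comul_pA
    (f := fun x y => f (S.act r x) (S.act r' y)) (by fun_prop) (by fun_prop)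
  simp only [← k₁]
  revert h
  refine S.carrier_ext (by fun_prop) (by fun_prop) fun a b => ?_
  simp (disch := fun_prop) only [pA_iA_mul_iB, _root_.map_smul, sw_smul, ← smul_sw]
  rw [hC.act_alpha_iA h₁ h₂]
  have k₂ := fun (p q : S.Carrier) => hC.twist_iB_Z (f := fun z z' =>
    f (S.act q z) (S.act p z')) (by fun_prop) (by fun_prop) b
  simp (disch := fun_prop) only [sw_comul_mul, sw_comul_iB, act_mul, act_iA,
    sw_comm Z (comul (R := k) (S.iA a)), ← k₂, ← smul_sw]
  simp (disch := fun_prop) only [sw_comul_iA, act_mul, act_iA, sw_comm Z (comul (R := k) a),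
    sw_comm Z (S.τ _)]

/-- The `pA ⊗ id` component of (QT4). Rebuilding the second leg from `pA` and `pB` of its coproduct
doubles `α` by (QT3). The copy seen by `pB` becomes `U`, and the two components already known apply
in turn. -/
theorem alpha_act_mul_comul (hC : S.FactorIdentities W X Y Z) (hσ : IsRightConormal S.σ)
    (hW : IsNormalized W) (hX : IsNormalized X) (hY : IsNormalized Y) (hZ : IsNormalized Z)
    {f : A → S.Carrier → P} (h₁ : ∀ y, IsLinearMap k (fun x => f x y))
    (h₂ : ∀ x, IsLinearMap k (fun y => f x y)) (h : S.Carrier) :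
    (sw (S.alpha W X Y Z) fun r r' => sw (comul (R := k) h) fun p q =>
        f (S.act r (S.pA p)) (r' * q))
      = sw (S.tensorQ W X Z) fun q q' => sw (comul (R := k) h) fun x y =>
        f (S.act y q) (x * q') := by
  have h₀ : (sw (S.alpha W X Y Z) fun r r' => sw (comul (R := k) h) fun p q =>
        f (S.act r (S.pA p)) (r' * q))
      = sw (S.alpha W X Y Z) fun r r' => sw (comul (R := k) r') fun s t =>
        sw (comul (R := k) h) fun p q => sw (comul (R := k) q) fun c d =>
          f (S.act r (S.pA p)) (S.iA (S.act s (S.pA c)) * S.iB (S.pB t * S.pB d)) := by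
    refine sw_congr fun r r' => ?_
    rw [sw_comm (comul (R := k) r')]
    refine sw_congr fun p q => ?_
    rw [← S.sw_comul_iA_pA_iB_pB (h₂ _) (r' * q), S.sw_comul_mul (by fun_prop) (by fun_prop)]
    simp only [S.pB_mul hσ, pA_mul]
  rw [h₀, hC.alpha_comul_right hσ hW hY (f := fun x y z => sw (comul (R := k) h) fun p q =>
      sw (comul (R := k) q) fun c d =>
        f (S.act x (S.pA p)) (S.iA (S.act y (S.pA c)) * S.iB (S.pB z * S.pB d)))
      (by fun_prop) (by fun_prop) (by fun_prop),
    hC.sw_alpha_pB_right hσ hW hX hY hZ (f := fun x y => sw (S.alpha W X Y Z) fun s s' =>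
      sw (comul (R := k) h) fun p q => sw (comul (R := k) q) fun c d =>
        f (S.act (x * s) (S.pA p)) (S.iA (S.act s' (S.pA c)) * S.iB (y * S.pB d)))
      (by fun_prop) (by fun_prop)]
  have k₁ := fun (u d : S.Carrier) (u' : B) => hC.alpha_act_comul (f := fun x y =>
    f (S.act u x) (S.iA y * S.iB (u' * S.pB d))) (by fun_prop) (by fun_prop)
  simp (disch := fun_prop) only [act_mul, ← sw_coassoc]
  simp only [sw_comm (S.alpha W X Y Z) (comul (R := k) h), k₁]
  simp (disch := fun_prop) only [sw_comm (comul (R := k) h) Z, sw_coassoc]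
  have k₂ := fun (p : S.Carrier) (z z' : A) => hC.tensorU_mul_comul hσ (f := fun a b =>
    f (S.act a z) (S.iA (S.act p z') * S.iB b)) (by fun_prop) (by fun_prop)
  simp (disch := fun_prop) only [sw_tensorQ, ← mul_assoc, mul_iA_eq hσ, sw_mul, map_sw (h₂ _),
    sw_coassoc]
  simp only [iB_mul, ← mul_assoc, ← act_mul] at k₂ ⊢
  simp only [sw_comm (S.tensorU W X) Z, sw_comm (S.tensorU W X) (comul (R := k) h), k₂]

/-- The same gluing in the first leg: (QT2) doubles `α`, the copy seen by `pB` becomes `V`, and the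
`pB ⊗ id` and `pA ⊗ id` components finish. -/
theorem alpha_mul_comul (hC : S.FactorIdentities W X Y Z) (hσ : IsRightConormal S.σ)
    (hW : IsNormalized W) (hX : IsNormalized X) (hY : IsNormalized Y) (hZ : IsNormalized Z)
    {f : S.Carrier → S.Carrier → P} (h₁ : ∀ y, IsLinearMap k (fun x => f x y))
    (h₂ : ∀ x, IsLinearMap k (fun y => f x y)) (h : S.Carrier) :
    (sw (S.alpha W X Y Z) fun r r' => sw (comul (R := k) h) fun p q => f (r * p) (r' * q))
      = sw (S.alpha W X Y Z) fun r r' => sw (comul (R := k) h) fun p q =>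
        f (q * r) (p * r') := by
  have h₀ : (sw (S.alpha W X Y Z) fun r r' => sw (comul (R := k) h) fun p q =>
        f (r * p) (r' * q))
      = sw (S.alpha W X Y Z) fun r r' => sw (comul (R := k) r) fun s t =>
        sw (comul (R := k) h) fun p q => sw (comul (R := k) p) fun c d =>
          f (S.iA (S.act s (S.pA c)) * S.iB (S.pB t * S.pB d)) (r' * q) := by
    refine sw_congr fun r r' => ?_
    rw [sw_comm (comul (R := k) r)]
    refine sw_congr fun p q => ?_
    rw [← S.sw_comul_iA_pA_iB_pB (h₁ _) (r * p), S.sw_comul_mul (by fun_prop) (by fun_prop)]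
    simp only [S.pB_mul hσ, pA_mul]
  rw [h₀, hC.alpha_comul_left hσ hX (f := fun x y z => sw (comul (R := k) h) fun p q =>
      sw (comul (R := k) p) fun c d =>
        f (S.iA (S.act x (S.pA c)) * S.iB (S.pB y * S.pB d)) (z * q))
      (by fun_prop) (by fun_prop) (by fun_prop)]
  have k₁ := fun (r r' : S.Carrier) => hC.sw_alpha_pB_left hσ hW hX hZ (f := fun v v' =>
    sw (comul (R := k) h) fun p q => sw (comul (R := k) p) fun c d =>
      f (S.iA (S.act r (S.pA c)) * S.iB (v * S.pB d)) (r' * v' * q)) (by fun_prop) (by fun_prop)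
  simp only [k₁]
  have k₂ := fun (c r r' : S.Carrier) => hC.tensorV_mul_comul hσ (f := fun a b =>
    f (S.iA (S.act r (S.pA c)) * S.iB a) (r' * b)) (by fun_prop) (by fun_prop)
  simp (disch := fun_prop) only [sw_coassoc, mul_assoc,
    sw_comm (S.tensorV W Y) (comul (R := k) h), k₂]
  have k₃ := fun (y : S.Carrier) => hC.alpha_act_mul_comul hσ hW hX hY hZ (f := fun a b =>
    sw (S.tensorV W Y) fun v v' => f (S.iA a * S.iB (S.pB y * v)) (b * v'))
    (by fun_prop) (by fun_prop)
  simp only [mul_assoc] at k₃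
  simp (disch := fun_prop) only [sw_comm (S.tensorV W Y) (comul (R := k) _), ← sw_coassoc]
  simp only [sw_comm (S.alpha W X Y Z) (comul (R := k) h), k₃]
  simp (disch := fun_prop) only [hC.alpha_eq_tensorQ_tensorV hσ]
  simp (disch := fun_prop) only [← mul_assoc, mul_iA_eq hσ, sw_mul, map_sw (h₁ _)]
  simp (disch := fun_prop) only [sw_comm (S.tensorV W Y) (comul (R := k) _),
    sw_comm (S.tensorQ W X Z) (comul (R := k) _), ← sw_coassoc, iB_mul, mul_assoc]

end FactorIdentities

end SmashBiproduct

/-! ### Translation of the quasitriangularity axioms into Sweedler form. -/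

section Legs

variable {k H : Type*} [Field k] [Ring H] [Bialgebra k H]

theorem leg12_eq_sw (R : H ⊗[k] H) :
    leg12 k H R = sw R fun r r' => (r ⊗ₜ[k] r') ⊗ₜ[k] (1 : H) := by
  revert R
  refine tensor_ext (by fun_prop) (by fun_prop) fun r r' => ?_
  simp (disch := fun_prop) only [sw_tmul]
  simp [leg12]

theorem leg13_eq_sw (R : H ⊗[k] H) :
    leg13 k H R = sw R fun r r' => (r ⊗ₜ[k] (1 : H)) ⊗ₜ[k] r' := by
  revert R
  refine tensor_ext (by fun_prop) (by fun_prop) fun r r' => ?_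
  simp (disch := fun_prop) only [sw_tmul]
  simp [leg13]

theorem leg23_eq_sw (R : H ⊗[k] H) :
    leg23 k H R = sw R fun r r' => ((1 : H) ⊗ₜ[k] r) ⊗ₜ[k] r' := by
  revert R
  refine tensor_ext (by fun_prop) (by fun_prop) fun r r' => ?_
  simp (disch := fun_prop) only [sw_tmul]
  simp [leg23]

theorem mul_eq_sw (R t : H ⊗[k] H) :
    R * t = sw R fun r r' => sw t fun p q => (r * p) ⊗ₜ[k] (r' * q) := by
  revert R
  refine tensor_ext (by fun_prop) (by fun_prop) fun r r' => ?_
  revert t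
  refine tensor_ext (by fun_prop) (by fun_prop) fun p q => ?_
  simp (disch := fun_prop) only [sw_tmul, Algebra.TensorProduct.tmul_mul_tmul]

theorem comm_mul_eq_sw (R t : H ⊗[k] H) :
    TensorProduct.comm k H H t * R = sw R fun r r' => sw t fun p q => (q * r) ⊗ₜ[k] (p * r') := by
  revert R
  refine tensor_ext (by fun_prop) (by fun_prop) fun r r' => ?_
  revert t
  refine tensor_ext (by fun_prop) (by fun_prop) fun p q => ?_
  simp (disch := fun_prop) only [sw_tmul, Algebra.TensorProduct.tmul_mul_tmul,
    TensorProduct.comm_tmul]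

/-- The quasitriangular structures in Sweedler notation. -/
theorem isQuasitriangularStructure_of_sw {R : H ⊗[k] H}
    (h₁ : (sw R fun r r' => Coalgebra.counit (R := k) r • r') = 1)
    (h₂ : (sw R fun r r' => Coalgebra.counit (R := k) r' • r) = 1)
    (h₃ : (sw R fun r r' => sw (Coalgebra.comul (R := k) r) fun r₁ r₂ =>
        (r₁ ⊗ₜ[k] r₂) ⊗ₜ[k] r')
      = sw R fun r r' => sw R fun s s' => (r ⊗ₜ[k] s) ⊗ₜ[k] (r' * s'))
    (h₄ : (sw R fun r r' => sw (Coalgebra.comul (R := k) r') fun r₁ r₂ =>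
        (r ⊗ₜ[k] r₁) ⊗ₜ[k] r₂)
      = sw R fun r r' => sw R fun s s' => ((r * s) ⊗ₜ[k] s') ⊗ₜ[k] r')
    (h₅ : ∀ h : H, (sw R fun r r' => sw (Coalgebra.comul (R := k) h) fun p q =>
        (r * p) ⊗ₜ[k] (r' * q))
      = sw R fun r r' => sw (Coalgebra.comul (R := k) h) fun p q => (q * r) ⊗ₜ[k] (p * r')) :
    IsQuasitriangularStructure k R := by
  have hR : ∀ {P : Type _} [AddCommGroup P] [Module k P] {F : H ⊗[k] H → P}
      (_ : IsLinearMap k F), F R = sw R fun r r' => F (r ⊗ₜ[k] r') := by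
    intro P _ _ F hF
    conv_lhs => rw [← sw_mk R]
    exact map_sw hF R _
  refine ⟨?_, ?_, ?_, ?_, fun h => ?_⟩
  · rw [hR (F := fun R => TensorProduct.lid k H (
        TensorProduct.map (Coalgebra.counit (R := k)) LinearMap.id R)) (by fun_prop), ← h₁]
    simp
  · rw [hR (F := fun R => TensorProduct.rid k H (
        TensorProduct.map LinearMap.id (Coalgebra.counit (R := k)) R)) (by fun_prop), ← h₂]
    simp
  · rw [hR (F := fun R => TensorProduct.map (Coalgebra.comul (R := k)) LinearMap.id R)
      (by fun_prop), leg13_eq_sw, leg23_eq_sw]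
    simp only [sw_mul, mul_sw, Algebra.TensorProduct.tmul_mul_tmul, one_mul, mul_one]
    rw [sw_comm R R, ← h₃]
    refine sw_congr fun r r' => ?_
    rw [TensorProduct.map_tmul, LinearMap.id_apply,
      ← map_sw (g := fun t => t ⊗ₜ[k] r') (by fun_prop), sw_mk]
  · rw [hR (F := fun R => (TensorProduct.assoc k H H H).symm
      (TensorProduct.map LinearMap.id (Coalgebra.comul (R := k)) R)) (by fun_prop), leg13_eq_sw,
      leg12_eq_sw]
    simp only [sw_mul, mul_sw, Algebra.TensorProduct.tmul_mul_tmul, one_mul, mul_one]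
    rw [sw_comm R R, ← h₄]
    refine sw_congr fun r r' => ?_
    rw [TensorProduct.map_tmul, LinearMap.id_apply]
    conv_lhs => rw [← sw_mk (Coalgebra.comul (R := k) r'),
      map_sw (g := fun t => (TensorProduct.assoc k H H H).symm (r ⊗ₜ[k] t)) (by fun_prop)]
    simp only [TensorProduct.assoc_symm_tmul]
  · rw [mul_eq_sw, comm_mul_eq_sw, h₅]

end Legs

theorem theorem3p6 {k A B : Type*} [Field k] [Ring A] [Algebra k A] [Coalgebra k A]
    [Ring B] [Algebra k B] [Coalgebra k B] (S : SmashBiproduct k A B)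
    (hσ : IsRightConormal S.σ)
    (W : B ⊗[k] B) (X : A ⊗[k] B) (Y : B ⊗[k] A) (Z : A ⊗[k] A)
    (hW : SmashBiproduct.IsNormalized W) (hX : SmashBiproduct.IsNormalized X)
    (hY : SmashBiproduct.IsNormalized Y) (hZ : SmashBiproduct.IsNormalized Z)
    (hC : S.FactorIdentities W X Y Z) :
    IsQuasitriangularStructure k (S.alpha W X Y Z) := by
  refine isQuasitriangularStructure_of_sw ?_ ?_
    (hC.alpha_comul_left hσ hX (f := fun x y z => (x ⊗ₜ[k] y) ⊗ₜ[k] z)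
      (by fun_prop) (by fun_prop) (by fun_prop))
    (hC.alpha_comul_right hσ hW hY (f := fun x y z => (x ⊗ₜ[k] y) ⊗ₜ[k] z)
      (by fun_prop) (by fun_prop) (by fun_prop))
    (hC.alpha_mul_comul hσ hW hX hY hZ (f := fun x y => x ⊗ₜ[k] y) (by fun_prop) (by fun_prop))
  -- In both halves of (QT1) the counit splits over the factorization, and `V` and `Q` contribute
  -- `1` separately.
  · simp (disch := fun_prop) only [hC.alpha_eq_tensorQ_tensorV hσ, 
      SmashBiproduct.counit_iA_mul_iB, mul_smul, ← smul_sw,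
      SmashBiproduct.sw_tensorV_counit_left hW hY, mul_one,
      SmashBiproduct.sw_tensorQ_counit_left hW hX hZ]
  · simp (disch := fun_prop) only [hC.alpha_eq_tensorQ_tensorV hσ, 
      Bialgebra.counit_mul, mul_smul, ← smul_sw,
      SmashBiproduct.sw_tensorV_counit_right hW hY, mul_one,
      SmashBiproduct.sw_tensorQ_counit_right hW hX hZ, SmashBiproduct.iA_one, SmashBiproduct.iB_one]
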